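/- **Theorem.** For $n\ge 3$ let $X=(X_{i,j})_{1\le i<j\le n}$ be a random vector in $[0,\infty)^{\binom n2}$ with a density $f$ that is log-concave and down-monotone ($f(x)\ge f(y)$ whenever $x\le y$ coordinatewise). For $p>0$ let $G_{X,p}$ be the random graph on $\{1,\dots,n\}$ in which $\{i,j\}$, $i<j$, is an edge if and only if $X_{i,j}\le p$. Let $\sigma_{\min}\ge 0$ and $M\ge 0$ be given by $$\sigma_{\min}^2=\min_{i<j}\mathbb E X_{i,j}^2,\qquad M^2=\max_{T}\ \sup_{y}\ \max_{(i,j)\notin T}\ \mathbb E\big(X_{i,j}^2\,\big|\,X_T=y\big),$$ where $T$ ranges over the nonempty sets of index pairs, $X_T=(X_e)_{e\in T}$, $y$ ranges over the points of $[0,\infty)^{T}$ at which the marginal density of $X_T$ is positive, and the conditional expectation is taken with respect to the conditional density obtained from $f$. There are absolute constants $c_1,c_2>0$ such that, for all such $n$ and $X$ with $M<\infty$, all $\beta>1$ and all $p>0$: (i) If $p<\dfrac{c_1\sigma_{\min}}{n}$, then $$\Pr\big(G_{X,p}\text{ has a component of order}\ge\beta\log n\big)<\frac{12}{n^{\beta-1}}.$$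 (ii) If $p>\dfrac{c_2M\log(eM/\sigma_{\min})}{n}$, then $$\Pr\big(G_{X,p}\text{ has a component of order in }[\beta\log n,n/2]\big)<\frac1{n^{\beta-1}}$$ and $$\Pr\big(G_{X,p}\text{ has a unique giant component of order}>n/2\big)>1-\frac{5\beta}{\log n}-\frac1{n^{\beta-1}}.$$ -/

import Mathlib

open MeasureTheory
open scoped ENNReal

/-- The index set `{(i, j) : 1 ≤ i < j ≤ n}` of the coordinates (vertices are numbered from `0`). -/
abbrev EdgeIdx (n : ℕ) : Type := {e : Fin n × Fin n // e.1 < e.2}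

/-- `f` vanishes outside `[0,∞)^ι`, is nonnegative, and on `[0,∞)^ι` it is log-concave
(`log f` is concave with the convention `log 0 = -∞`) and down-monotone
(`f x ≥ f y` whenever `x ≤ y` coordinatewise). -/
structure IsLogConcaveDownMonotone {ι : Type*} (f : (ι → ℝ) → ℝ) : Prop where
  nonneg : ∀ x, 0 ≤ f x
  support : ∀ x, ¬ 0 ≤ x → f x = 0
  logConcave : ∀ x y : ι → ℝ, 0 ≤ x → 0 ≤ y → ∀ s t : ℝ, 0 < s → 0 < t → s + t = 1 →
    f x ^ s * f y ^ t ≤ f (s • x + t • y)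
  downMonotone : ∀ x y : ι → ℝ, 0 ≤ x → x ≤ y → f y ≤ f x

/-- The graph `G_{x,p}` on `n` vertices: for `i < j`, `{i, j}` is an edge iff `x_{ij} ≤ p`. -/
def thresholdGraph {n : ℕ} (x : EdgeIdx n → ℝ) (p : ℝ) : SimpleGraph (Fin n) where
  Adj i j := (∃ h : i < j, x ⟨(i, j), h⟩ ≤ p) ∨ (∃ h : j < i, x ⟨(j, i), h⟩ ≤ p)
  symm := ⟨fun _ _ h => h.symm⟩
  loopless := ⟨fun i h => by
    rcases h with ⟨h, _⟩ | ⟨h, _⟩ <;> exact lt_irrefl i h⟩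

/-- The order (number of vertices) of a connected component. -/
noncomputable def componentOrder {V : Type*} {G : SimpleGraph V} (C : G.ConnectedComponent) : ℕ :=
  C.supp.ncard

/-- `σ_min`, where `σ_min ^ 2 = min_{i < j} 𝔼 X_{ij} ^ 2`. -/
noncomputable def sigmaMin {Ω : Type*} [MeasurableSpace Ω] (P : Measure Ω) {n : ℕ}
    (X : Ω → EdgeIdx n → ℝ) : ℝ :=
  √(⨅ e : EdgeIdx n, ∫ ω, X ω e ^ 2 ∂P)

/-- The vector with coordinates `y` on `T` and `z` off `T`. -/
def glue {ι : Type*} [DecidableEq ι] (T : Finset ι) (y : {i // i ∈ T} → ℝ)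
    (z : {i // i ∉ T} → ℝ) : ι → ℝ :=
  fun i => if h : i ∈ T then y ⟨i, h⟩ else z ⟨i, h⟩

/-- The marginal density `f_T(y)` of `X_T`, for `X` with density `f`. -/
noncomputable def marginalDensity {ι : Type*} [Fintype ι] [DecidableEq ι]
    (f : (ι → ℝ) → ℝ) (T : Finset ι) (y : {i // i ∈ T} → ℝ) : ℝ≥0∞ :=
  ∫⁻ z : {i // i ∉ T} → ℝ, ENNReal.ofReal (f (glue T y z))

/-- `𝔼 (X_e ^ 2 | X_T = y)` for `e ∉ T`, computed from the conditional density
`z ↦ f (y, z) / f_T(y)`; meaningful where `f_T(y) ≠ 0`. -/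
noncomputable def condSecondMoment {ι : Type*} [Fintype ι] [DecidableEq ι]
    (f : (ι → ℝ) → ℝ) (T : Finset ι) (y : {i // i ∈ T} → ℝ) (e : {i // i ∉ T}) : ℝ≥0∞ :=
  (∫⁻ z : {i // i ∉ T} → ℝ, ENNReal.ofReal (z e ^ 2 * f (glue T y z))) / marginalDensity f T y

/-- `max_T sup_y max_{e ∉ T} 𝔼 (X_e ^ 2 | X_T = y)`, over nonempty `T` and over those
`y ∈ [0,∞)^T` at which the conditional distribution exists. -/
noncomputable def maxCondSecondMoment {ι : Type*} [Fintype ι] [DecidableEq ι]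
    (f : (ι → ℝ) → ℝ) : ℝ≥0∞ :=
  ⨆ (T : Finset ι) (_ : T.Nonempty) (y : {i // i ∈ T} → ℝ) (_ : 0 ≤ y)
    (_ : marginalDensity f T y ≠ 0) (e : {i // i ∉ T}), condSecondMoment f T y e

/-- `M`, on the scale of the coordinates: the square root of the largest conditional
second moment (to be used when that moment is finite). -/
noncomputable def maxCondRMS {ι : Type*} [Fintype ι] [DecidableEq ι]
    (f : (ι → ℝ) → ℝ) : ℝ :=
  √(maxCondSecondMoment f).toReal

/-! Both regimes are first-moment arguments over trees and cuts. Independence of the edges is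
replaced by two estimates, collected in `HasTailBounds`: all coordinates in `S` are at most `p` with
probability at most `(12 e p / σ) ^ |S|`, and each further demand `p < X e` on another coordinate
costs a factor `exp (-3 p / (8 M))`.

The first probability is at most `p ^ |S|` times the marginal density of `X_S` at the origin, its
maximum. A Loomis–Whitney inequality with sections through the origin
(`IsLogConcaveAntitone.zero_mul_pow_le`) bounds that value by `e ^ |S|` times the product of the
one-dimensional marginal densities at `0`, and each of these is at most `12 / σ`
(`zero_le_of_secondMoment`). For the second estimate, the density of a coordinate conditioned on
others is again log-concave and antitone, so second moment at most `M ^ 2` forces an exponential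
tail (`tail_le_exp`). Both need marginals to stay log-concave, which is Prékopa–Leindler; for
decreasing functions on a half-line it is easy, since superlevel sets are intervals from `0`.

A component with at least `k` vertices contains a tree with `k - 1` edges, and at most `(e n) ^ k`
candidates have to be counted, so the union bound decays geometrically when `p n / σ` is small. A
component of order exactly `k ≤ n / 2` also has `k (n - k) ≥ k n / 2` absent boundary edges. They
supply a factor `exp (-3 p n / (16 M))` per tree edge, which beats `p n / σ` once `p n / M` exceeds
a large multiple of `log (e M / σ)`. If no component exceeds `n / 2`, some union of components has
between `n / 3` and `2 n / 3` vertices, and a cut of order `n ^ 2` is empty; this stays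
exponentially unlikely after summing over `2 ^ n` vertex sets. -/

/-! ### Prékopa–Leindler for antitone functions on the half-line. -/

/-- Lebesgue measure on `[0,∞)`. -/
noncomputable def halfLine : Measure ℝ := volume.restrict (Set.Ici 0)

instance : SigmaFinite halfLine := by unfold halfLine; infer_instance

theorem ae_halfLine_nonneg : ∀ᵐ r ∂halfLine, (0 : ℝ) ≤ r :=
  ae_restrict_mem measurableSet_Ici

theorem volume_lt_inter_Ioo (c : ℝ≥0∞) :
    volume ({t : ℝ | ENNReal.ofReal t < c} ∩ Set.Ioo 0 1) = min c 1 := by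
  have hm : min c 1 ≠ ∞ := ne_top_of_le_ne_top ENNReal.one_ne_top (min_le_right _ _)
  have h : {t : ℝ | ENNReal.ofReal t < c} ∩ Set.Ioo 0 1 = Set.Ioo 0 (min c 1).toReal := by
    ext t
    simp only [Set.mem_inter_iff, Set.mem_ofPred_eq, Set.mem_Ioo]
    constructor
    · rintro ⟨h1, h2, h3⟩
      exact ⟨h2, (ENNReal.ofReal_lt_iff_lt_toReal h2.le hm).1
        (lt_min h1 (ENNReal.ofReal_lt_one.2 h3))⟩
    · rintro ⟨h1, h2⟩
      have := lt_min_iff.1 ((ENNReal.ofReal_lt_iff_lt_toReal h1.le hm).2 h2)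
      exact ⟨this.1, h1, ENNReal.ofReal_lt_one.1 this.2⟩
  rw [h, Real.volume_Ioo, sub_zero, ENNReal.ofReal_toReal hm]

/-- Layer-cake formula cut off at height `1`, to be used for functions normalised to equal `1` at
the origin. -/
theorem lintegral_min_one_eq {f : ℝ → ℝ≥0∞} (hf : Measurable f) :
    ∫⁻ x, min (f x) 1 ∂halfLine
      = ∫⁻ t in Set.Ioo (0 : ℝ) 1, halfLine {x | ENNReal.ofReal t < f x} := by
  have hm : MeasurableSet {q : ℝ × ℝ | ENNReal.ofReal q.2 < f q.1} :=
    measurableSet_lt (ENNReal.measurable_ofReal.comp measurable_snd) (hf.comp measurable_fst)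
  have h1 : ∀ x, min (f x) 1 = ∫⁻ t in Set.Ioo (0 : ℝ) 1,
      Set.indicator {q : ℝ × ℝ | ENNReal.ofReal q.2 < f q.1} 1 (x, t) := by
    intro x
    rw [← volume_lt_inter_Ioo, ← Measure.restrict_apply (measurableSet_lt
      ENNReal.measurable_ofReal measurable_const), ← lintegral_indicator_one (measurableSet_lt
      ENNReal.measurable_ofReal measurable_const)]
    rfl
  simp_rw [h1]
  rw [lintegral_lintegral_swap (f := fun x t => Set.indicator
    {q : ℝ × ℝ | ENNReal.ofReal q.2 < f q.1} 1 (x, t))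
    ((measurable_one.indicator hm).aemeasurable)]
  refine lintegral_congr fun t => ?_
  rw [← lintegral_indicator_one (measurableSet_lt measurable_const hf)]
  rfl

/-- Turns lengths of superlevel sets into suprema, so that Brunn–Minkowski on the line reduces to
adding suprema. -/
theorem halfLine_eq_iSup {U : Set ℝ} (hU : ∀ r ∈ U, ∀ r' ≤ r, r' ∈ U) :
    halfLine U = ⨆ r ∈ U, ENNReal.ofReal r := by
  apply le_antisymm
  · rcases eq_or_ne (⨆ r ∈ U, ENNReal.ofReal r) ∞ with h | h
    · rw [h]; exact le_top
    · have : U ∩ Set.Ici 0 ⊆ Set.Icc 0 (⨆ r ∈ U, ENNReal.ofReal r).toReal := by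
        rintro x ⟨hx, hx0⟩
        exact ⟨hx0, (ENNReal.ofReal_le_iff_le_toReal h).1
          (le_iSup₂ (f := fun r (_ : r ∈ U) => ENNReal.ofReal r) x hx)⟩
      rw [halfLine, Measure.restrict_apply' measurableSet_Ici]
      refine (measure_mono this).trans ?_
      rw [Real.volume_Icc, sub_zero, ENNReal.ofReal_toReal h]
  · refine iSup₂_le fun r hr => ?_
    rw [halfLine, Measure.restrict_apply' measurableSet_Ici]
    calc ENNReal.ofReal r = volume (Set.Icc 0 r) := by rw [Real.volume_Icc, sub_zero]
      _ ≤ _ := measure_mono (fun x hx => (⟨hU r hr x hx.2, hx.1⟩ : x ∈ U ∩ Set.Ici 0))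

theorem ennreal_amgm (a b : ℝ≥0∞) {s t : ℝ} (hs : 0 < s) (ht : 0 < t) (hst : s + t = 1) :
    a ^ s * b ^ t ≤ ENNReal.ofReal s * a + ENNReal.ofReal t * b := by
  rcases eq_or_ne a ∞ with rfl | ha
  · simp [ENNReal.mul_top, hs]
  rcases eq_or_ne b ∞ with rfl | hb
  · simp [ENNReal.mul_top, ht]
  lift a to NNReal using ha
  lift b to NNReal using hb
  have := NNReal.geom_mean_le_arith_mean2_weighted s.toNNReal t.toNNReal a b (by
    rw [← Real.toNNReal_add hs.le ht.le, hst, Real.toNNReal_one])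
  rw [Real.coe_toNNReal _ hs.le, Real.coe_toNNReal _ ht.le] at this
  rw [← ENNReal.coe_rpow_of_nonneg _ hs.le, ← ENNReal.coe_rpow_of_nonneg _ ht.le]
  unfold ENNReal.ofReal
  exact_mod_cast this

theorem lintegral_halfLine_min_eq {f : ℝ → ℝ≥0∞} (hf : Antitone f) {c : ℝ≥0∞} (h : f 0 ≤ c) :
    ∫⁻ x, min (f x) c ∂halfLine = ∫⁻ x, f x ∂halfLine := by
  refine lintegral_congr_ae ?_
  filter_upwards [ae_halfLine_nonneg] with x hx
  exact min_eq_left ((hf hx).trans h)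

/-- After division by the values at `0`, the superlevel sets at each height below `1` are nonempty
and down-closed, so their lengths combine additively. Integrating over heights bounds the weighted
arithmetic mean of the integrals, which dominates the geometric one. -/
theorem prekopa_leindler_of_finite {f g h : ℝ → ℝ≥0∞} (hf : Antitone f) (hg : Antitone g)
    (hh : Antitone h) {s t : ℝ} (hs : 0 < s) (ht : 0 < t) (hst : s + t = 1)
    (H : ∀ a b, f a ^ s * g b ^ t ≤ h (s * a + t * b))
    (hf0 : f 0 ≠ 0) (hf1 : f 0 ≠ ∞) (hg0 : g 0 ≠ 0) (hg1 : g 0 ≠ ∞) :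
    (∫⁻ x, f x ∂halfLine) ^ s * (∫⁻ x, g x ∂halfLine) ^ t ≤ ∫⁻ x, h x ∂halfLine := by
  set A := f 0
  set B := g 0
  set C := A ^ s * B ^ t
  have hC0 : C ≠ 0 := mul_ne_zero (by simp [hf0, hf1]) (by simp [hg0, hg1])
  have hC1 : C ≠ ∞ := ENNReal.mul_ne_top (ENNReal.rpow_ne_top_of_nonneg hs.le hf1)
    (ENNReal.rpow_ne_top_of_nonneg ht.le hg1)
  have anti : ∀ (c : ℝ≥0∞) {k : ℝ → ℝ≥0∞}, Antitone k → Antitone fun x => k x / c :=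
    fun c k hk x y hxy => ENNReal.div_le_div_right (hk hxy) c
  have hdiv : ∀ u v : ℝ≥0∞, (u / A) ^ s * (v / B) ^ t = u ^ s * v ^ t / C := by
    intro u v
    rw [ENNReal.div_rpow_of_nonneg _ _ hs.le, ENNReal.div_rpow_of_nonneg _ _ ht.le]
    simp only [div_eq_mul_inv, C]
    rw [ENNReal.mul_inv (by simp [hf0, hf1]) (by simp [hg0, hg1])]
    ring
  have hlevel : ∀ u ∈ Set.Ioo (0 : ℝ) 1,
      ENNReal.ofReal s * halfLine {x | ENNReal.ofReal u < f x / A}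
        + ENNReal.ofReal t * halfLine {x | ENNReal.ofReal u < g x / B}
        ≤ halfLine {x | ENNReal.ofReal u < h x / C} := by
    intro u hu
    have sup : ∀ (c : ℝ≥0∞) {k : ℝ → ℝ≥0∞}, Antitone k →
        halfLine {x | ENNReal.ofReal u < k x / c}
          = ⨆ r ∈ {x | ENNReal.ofReal u < k x / c}, ENNReal.ofReal r := fun c k hk =>
      halfLine_eq_iSup fun r hr r' hr' =>
        lt_of_lt_of_le (show ENNReal.ofReal u < k r / c from hr) (anti c hk hr')
    rw [sup A hf, sup B hg, sup C hh]
    simp_rw [ENNReal.mul_iSup]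
    refine ENNReal.biSup_add_biSup_le' ⟨0, ?_⟩ ⟨0, ?_⟩ fun a ha b hb => ?_
    · simpa [A, ENNReal.div_self hf0 hf1] using hu.2
    · simpa [B, ENNReal.div_self hg0 hg1] using hu.2
    -- Points of a superlevel set may be negative; they can be moved to `0`, where the normalised
    -- value is `1 > u`, and on nonnegative points `ENNReal.ofReal` is additive.
    · have pos : ∀ (k : ℝ → ℝ≥0∞), k 0 ≠ 0 → k 0 ≠ ∞ → ∀ r, ENNReal.ofReal u < k r / k 0 →
          ENNReal.ofReal u < k (max r 0) / k 0 := by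
        intro k hk0 hk1 r hr
        rcases max_choice r 0 with h | h <;> rw [h]
        · exact hr
        · rw [ENNReal.div_self hk0 hk1]
          exact ENNReal.ofReal_lt_one.2 hu.2
      have ha' := pos f hf0 hf1 a ha
      have hb' := pos g hg0 hg1 b hb
      have hmem : s * max a 0 + t * max b 0 ∈ {x | ENNReal.ofReal u < h x / C} := by
        rw [Set.mem_ofPred_eq]
        calc ENNReal.ofReal u = ENNReal.ofReal u ^ s * ENNReal.ofReal u ^ t := by
              rw [← ENNReal.rpow_add_of_nonneg _ _ hs.le ht.le, hst, ENNReal.rpow_one]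
          _ < (f (max a 0) / A) ^ s * (g (max b 0) / B) ^ t :=
              ENNReal.mul_lt_mul (ENNReal.rpow_lt_rpow ha' hs) (ENNReal.rpow_lt_rpow hb' ht)
          _ = f (max a 0) ^ s * g (max b 0) ^ t / C := hdiv _ _
          _ ≤ _ := ENNReal.div_le_div_right (H _ _) C
      refine le_trans ?_ (le_iSup₂ (f := fun r (_ : r ∈ {x | ENNReal.ofReal u < h x / C}) =>
        ENNReal.ofReal r) _ hmem)
      rw [← ENNReal.ofReal_mul hs.le, ← ENNReal.ofReal_mul ht.le,
        ENNReal.ofReal_add (by positivity) (by positivity)]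
      gcongr <;> exact le_max_left _ _
  have mdiv : ∀ (c : ℝ≥0∞) {k : ℝ → ℝ≥0∞}, Antitone k → c ≠ 0 →
      ∫⁻ x, k x / c ∂halfLine = (∫⁻ x, k x ∂halfLine) / c := by
    intro c k hk hc
    simp_rw [div_eq_mul_inv]
    rw [lintegral_mul_const _ hk.measurable]
  have h1 : (∫⁻ x, f x ∂halfLine) ^ s * (∫⁻ x, g x ∂halfLine) ^ t / C
      ≤ (∫⁻ x, h x ∂halfLine) / C := by
    rw [← hdiv, ← mdiv A hf hf0, ← mdiv B hg hg0, ← mdiv C hh hC0]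
    refine (ennreal_amgm _ _ hs ht hst).trans ?_
    rw [← lintegral_halfLine_min_eq (anti A hf) (ENNReal.div_self hf0 hf1).le,
      ← lintegral_halfLine_min_eq (anti B hg) (ENNReal.div_self hg0 hg1).le,
      lintegral_min_one_eq (anti A hf).measurable, lintegral_min_one_eq (anti B hg).measurable,
      ← lintegral_const_mul' _ _ ENNReal.ofReal_ne_top,
      ← lintegral_const_mul' _ _ ENNReal.ofReal_ne_top]
    refine (le_lintegral_add _ _).trans ?_
    refine (setLIntegral_mono' measurableSet_Ioo hlevel).trans ?_
    rw [← lintegral_min_one_eq (anti C hh).measurable]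
    exact lintegral_mono fun x => min_le_left _ _
  simpa [ENNReal.div_mul_cancel hC0 hC1] using mul_le_mul_left h1 C

theorem tendsto_lintegral_min_nat {α : Type*} [MeasurableSpace α] {μ : Measure α}
    {f : α → ℝ≥0∞} (hf : Measurable f) :
    Filter.Tendsto (fun N : ℕ => ∫⁻ x, min (f x) N ∂μ) Filter.atTop (nhds (∫⁻ x, f x ∂μ)) := by
  refine lintegral_tendsto_of_tendsto_of_monotone
    (fun N => (hf.min measurable_const).aemeasurable) ?_ ?_
  · exact Filter.Eventually.of_forall fun x a b hab => min_le_min le_rfl (Nat.cast_le.2 hab)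
  · refine Filter.Eventually.of_forall fun x => ?_
    have := (tendsto_const_nhds (x := f x)).min ENNReal.tendsto_nat_nhds_top
    simpa using this

/-- Truncating `f` and `g` at height `N` preserves the hypothesis and makes the values at `0`
finite; monotone convergence removes the truncation. Zero integrals are treated apart because
multiplication is not continuous at `(0, ∞)`. -/
theorem prekopa_leindler_antitone {f g h : ℝ → ℝ≥0∞} (hf : Antitone f) (hg : Antitone g)
    (hh : Antitone h) {s t : ℝ} (hs : 0 < s) (ht : 0 < t) (hst : s + t = 1)
    (H : ∀ a b, f a ^ s * g b ^ t ≤ h (s * a + t * b)) :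
    (∫⁻ x, f x ∂halfLine) ^ s * (∫⁻ x, g x ∂halfLine) ^ t ≤ ∫⁻ x, h x ∂halfLine := by
  have zero : ∀ {k : ℝ → ℝ≥0∞}, Antitone k → k 0 = 0 → ∫⁻ x, k x ∂halfLine = 0 := by
    intro k hk h0
    rw [← lintegral_halfLine_min_eq hk h0.le]; simp
  rcases eq_or_ne (∫⁻ x, f x ∂halfLine) 0 with hf0 | hf0
  · simp [hf0, hs]
  rcases eq_or_ne (∫⁻ x, g x ∂halfLine) 0 with hg0 | hg0
  · simp [hg0, ht]
  have lim := ENNReal.Tendsto.mul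
    ((tendsto_lintegral_min_nat (μ := halfLine) hf.measurable).ennrpow_const s)
    (Or.inl (by simp [hf0, hs.not_gt]))
    ((tendsto_lintegral_min_nat (μ := halfLine) hg.measurable).ennrpow_const t)
    (Or.inl (by simp [hg0, ht.not_gt]))
  refine le_of_tendsto lim ?_
  filter_upwards [Filter.eventually_ge_atTop 1] with N hN
  have hN0 : (N : ℝ≥0∞) ≠ 0 := by simp; omega
  refine prekopa_leindler_of_finite (fun x y hxy => min_le_min (hf hxy) le_rfl)
    (fun x y hxy => min_le_min (hg hxy) le_rfl) hh hs ht hst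
    (fun a b => le_trans ?_ (H a b)) ?_ ?_ ?_ ?_
  · gcongr <;> exact min_le_left _ _
  · exact fun h => hf0 (zero hf (by simpa [hN0] using h))
  · exact ne_top_of_le_ne_top (ENNReal.natCast_ne_top N) (min_le_right _ _)
  · exact fun h => hg0 (zero hg (by simpa [hN0] using h))
  · exact ne_top_of_le_ne_top (ENNReal.natCast_ne_top N) (min_le_right _ _)

/-! ### Log-concave antitone functions and their marginals. -/

/-- An extended-valued log-concave antitone function on `[0,∞)^ι`, extended to all of `ι → ℝ`
so as to depend on the positive parts of the coordinates only. -/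
structure IsLogConcaveAntitone {ι : Type*} (F : (ι → ℝ) → ℝ≥0∞) : Prop where
  measurable : Measurable F
  antitone : Antitone F
  sup_zero : ∀ x, F (x ⊔ 0) = F x
  logConcave : ∀ x y : ι → ℝ, ∀ s t : ℝ, 0 < s → 0 < t → s + t = 1 →
    F x ^ s * F y ^ t ≤ F (s • x + t • y)

/-- Integration over the coordinates in `s`, each running through `[0,∞)`. -/
noncomputable abbrev integrateOut {ι : Type*} [DecidableEq ι] (s : Finset ι)
    (F : (ι → ℝ) → ℝ≥0∞) : (ι → ℝ) → ℝ≥0∞ :=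
  lmarginal (fun _ => halfLine) s F

theorem integrateOut_insert {ι : Type*} [DecidableEq ι] {s : Finset ι} {F : (ι → ℝ) → ℝ≥0∞}
    (hF : Measurable F) {i : ι} (hi : i ∉ s) (x : ι → ℝ) :
    integrateOut (insert i s) F x
      = ∫⁻ r, integrateOut s F (Function.update x i r) ∂halfLine :=
  lmarginal_insert F hF hi x

namespace IsLogConcaveAntitone

variable {ι : Type*} {F : (ι → ℝ) → ℝ≥0∞}

theorem slice_antitone [DecidableEq ι] (hF : IsLogConcaveAntitone F) (x : ι → ℝ) (i : ι) :
    Antitone fun r => F (Function.update x i r) := fun _ _ h =>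
  hF.antitone (update_le_update_iff.2 ⟨h, fun _ _ => le_rfl⟩)

theorem slice_logConcave [DecidableEq ι] (hF : IsLogConcaveAntitone F) (x : ι → ℝ) (i : ι)
    {s t : ℝ} (hs : 0 < s) (ht : 0 < t) (hst : s + t = 1) (a b : ℝ) :
    F (Function.update x i a) ^ s * F (Function.update x i b) ^ t
      ≤ F (Function.update x i (s * a + t * b)) := by
  refine (hF.logConcave _ _ s t hs ht hst).trans_eq (congrArg F ?_)
  ext j
  rcases eq_or_ne j i with rfl | hj
  · simp
  · simp [hj, ← add_mul, hst]

/-- Log-concavity of the marginal is one-dimensional Prékopa–Leindler applied to the slices in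
direction `i` through `x`, `y` and `s • x + t • y`. -/
theorem integrateOut_singleton [DecidableEq ι] (hF : IsLogConcaveAntitone F) (i : ι) :
    IsLogConcaveAntitone fun x => ∫⁻ r, F (Function.update x i r) ∂halfLine where
  measurable := by
    rw [← lmarginal_singleton (μ := fun _ : ι => halfLine)]
    exact hF.measurable.lmarginal _
  antitone x y h := lintegral_mono fun r =>
    hF.antitone (update_le_update_iff.2 ⟨le_rfl, fun j _ => h j⟩)
  sup_zero x := by
    refine lintegral_congr fun r => ?_
    rw [← hF.sup_zero, ← hF.sup_zero (Function.update x i r)]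
    congr 1
    ext j
    rcases eq_or_ne j i with rfl | hj
    · simp
    · simp [hj]
  logConcave x y s t hs ht hst := by
    refine prekopa_leindler_antitone (hF.slice_antitone x i) (hF.slice_antitone y i)
      (hF.slice_antitone _ i) hs ht hst fun a b => ?_
    refine (hF.logConcave _ _ s t hs ht hst).trans_eq (congrArg F ?_)
    ext j
    rcases eq_or_ne j i with rfl | hj
    · simp
    · simp [hj]

theorem integrateOut [DecidableEq ι] (hF : IsLogConcaveAntitone F) (s : Finset ι) :
    IsLogConcaveAntitone (integrateOut s F) := by
  induction s using Finset.induction_on with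
  | empty => simpa [_root_.integrateOut] using hF
  | insert i s hi ih =>
    have : _root_.integrateOut (insert i s) F
        = fun x => ∫⁻ r, _root_.integrateOut s F (Function.update x i r) ∂halfLine :=
      funext fun x => integrateOut_insert hF.measurable hi x
    rw [this]
    exact ih.integrateOut_singleton i

theorem min_const (hF : IsLogConcaveAntitone F) (c : ℝ≥0∞) :
    IsLogConcaveAntitone fun x => min (F x) c where
  measurable := hF.measurable.min measurable_const
  antitone _ _ h := min_le_min (hF.antitone h) le_rfl
  sup_zero x := by simp only [hF.sup_zero]
  logConcave x y s t hs ht hst := by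
    refine le_min (le_trans ?_ (hF.logConcave x y s t hs ht hst)) ?_
    · gcongr <;> exact min_le_left _ _
    · calc _ ≤ c ^ s * c ^ t := by gcongr <;> exact min_le_right _ _
        _ = c := by rw [← ENNReal.rpow_add_of_nonneg _ _ hs.le ht.le, hst, ENNReal.rpow_one]

theorem le_zero (hF : IsLogConcaveAntitone F) (x : ι → ℝ) : F x ≤ F 0 := by
  rw [← hF.sup_zero]
  exact hF.antitone le_sup_right

theorem le_update_zero [DecidableEq ι] (hF : IsLogConcaveAntitone F) (x : ι → ℝ) (i : ι) :
    F x ≤ F (Function.update x i 0) := by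
  rw [← hF.sup_zero x]
  rw [← hF.sup_zero (Function.update x i 0)]
  apply hF.antitone
  intro j
  rcases eq_or_ne j i with rfl | hj
  · simp
  · simp [hj]

/-- Log-concavity along the segment to the origin, where `F` is largest. -/
theorem rpow_le_smul (hF : IsLogConcaveAntitone F) (h0 : F 0 = 1) (x : ι → ℝ) {θ : ℝ}
    (h1 : 0 < θ) (h2 : θ < 1) : F x ^ θ ≤ F (θ • x) := by
  simpa [h0] using hF.logConcave x 0 θ (1 - θ) h1 (by linarith) (by ring)

end IsLogConcaveAntitone

/-! ### The Loomis–Whitney inequality. -/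

section LoomisWhitney

variable {ι : Type*} [DecidableEq ι]

/-- Coordinates are integrated one at a time. On integrating `j`, the factor of `g j` is constant
and comes out; the exponents of the other `|S| - 1` factors sum to `1`, so Hölder applies. Allowing
`s ⊆ S` keeps the exponent fixed in the induction. -/
theorem lmarginal_prod_rpow_le {μ : ι → Measure ℝ} [∀ i, SigmaFinite (μ i)] (S : Finset ι)
    (hS : 2 ≤ S.card) {g : ι → (ι → ℝ) → ℝ≥0∞} (hg : ∀ i, Measurable (g i))
    (hgi : ∀ i x r, g i (Function.update x i r) = g i x) {s : Finset ι} (hs : s ⊆ S) (x : ι → ℝ) :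
    lmarginal μ s (fun x => ∏ i ∈ S, g i x ^ (1 / (S.card - 1 : ℝ))) x
      ≤ ∏ i ∈ S, lmarginal μ (s.erase i) (g i) x ^ (1 / (S.card - 1 : ℝ)) := by
  have hS' : (2 : ℝ) ≤ S.card := by exact_mod_cast hS
  set q : ℝ := 1 / (S.card - 1 : ℝ)
  have hq : 0 ≤ q := by apply one_div_nonneg.2; linarith
  have hm : Measurable fun x => ∏ i ∈ S, g i x ^ q :=
    Finset.measurable_fun_prod _ fun i _ => (hg i).pow_const _
  induction s using Finset.induction_on generalizing x with
  | empty => simp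
  | insert j s hj ih =>
    have hjS : j ∈ S := hs (Finset.mem_insert_self _ _)
    rw [lmarginal_insert _ hm hj]
    calc ∫⁻ r, lmarginal μ s (fun x => ∏ i ∈ S, g i x ^ q) (Function.update x j r) ∂μ j
        ≤ ∫⁻ r, ∏ i ∈ S, lmarginal μ (s.erase i) (g i) (Function.update x j r) ^ q ∂μ j :=
          lintegral_mono fun r => ih ((Finset.subset_insert _ _).trans hs) _
      _ = ∫⁻ r, lmarginal μ s (g j) x ^ q * ∏ i ∈ S.erase j,
            lmarginal μ (s.erase i) (g i) (Function.update x j r) ^ q ∂μ j := by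
          refine lintegral_congr fun r => ?_
          rw [← Finset.mul_prod_erase _ _ hjS, Finset.erase_eq_of_notMem hj,
            lmarginal_update_of_notMem (hg j) hj]
          congr 3
          ext y
          exact hgi j y r
      _ = lmarginal μ s (g j) x ^ q * ∫⁻ r, ∏ i ∈ S.erase j,
            lmarginal μ (s.erase i) (g i) (Function.update x j r) ^ q ∂μ j := by
          refine lintegral_const_mul _ ?_
          exact Finset.measurable_fun_prod _ fun i _ =>
            (((hg i).lmarginal μ).comp (measurable_update x)).pow_const _
      _ ≤ lmarginal μ s (g j) x ^ q * ∏ i ∈ S.erase j, (∫⁻ r,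
            lmarginal μ (s.erase i) (g i) (Function.update x j r) ∂μ j) ^ q := by
          gcongr
          refine ENNReal.lintegral_prod_norm_pow_le _
            (fun i _ => (((hg i).lmarginal μ).comp (measurable_update x)).aemeasurable) ?_
            fun _ _ => hq
          rw [Finset.sum_const, Finset.card_erase_of_mem hjS, nsmul_eq_mul,
            Nat.cast_sub (by omega), Nat.cast_one]
          exact mul_one_div_cancel (by linarith)
      _ = _ := by
          rw [← Finset.mul_prod_erase _ _ hjS, Finset.erase_insert hj]
          congr 1
          refine Finset.prod_congr rfl fun i hi => ?_
          rw [Finset.erase_insert_of_ne (Finset.ne_of_mem_erase hi).symm,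
            lmarginal_insert _ (hg i) (fun h => hj (Finset.mem_of_mem_erase h))]

end LoomisWhitney

/-! ### Loomis–Whitney with sections through the origin. -/

theorem lintegral_halfLine_comp_mul {h : ℝ → ℝ≥0∞} (hh : Measurable h) {θ : ℝ} (hθ : 0 < θ) :
    ∫⁻ r, h (θ * r) ∂halfLine = ENNReal.ofReal θ⁻¹ * ∫⁻ r, h r ∂halfLine := by
  have h1 : ∀ k : ℝ → ℝ≥0∞, ∫⁻ r, k r ∂halfLine = ∫⁻ r, (Set.Ici 0).indicator k r :=
    fun k => (lintegral_indicator measurableSet_Ici _).symm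
  rw [h1, h1, ← abs_of_pos (inv_pos.2 hθ), ← smul_eq_mul, ← lintegral_smul_measure,
    ← Real.map_volume_mul_left hθ.ne', lintegral_map (hh.indicator measurableSet_Ici)
      (measurable_const_mul θ)]
  refine lintegral_congr fun r => ?_
  simp [Set.indicator, mul_nonneg_iff_of_pos_left hθ]

theorem integrateOut_comp_smul {ι : Type*} [DecidableEq ι] {F : (ι → ℝ) → ℝ≥0∞}
    (hF : Measurable F) {θ : ℝ} (hθ : 0 < θ) (s : Finset ι) (x : ι → ℝ) :
    integrateOut s (fun y => F (θ • y)) x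
      = ENNReal.ofReal θ⁻¹ ^ s.card * integrateOut s F (θ • x) := by
  induction s using Finset.induction_on generalizing x with
  | empty => simp
  | insert i s hi ih =>
    rw [integrateOut_insert (F := fun y => F (θ • y)) (hF.comp (measurable_const_smul θ)) hi,
      integrateOut_insert hF hi]
    simp_rw [ih]
    have h1 : ∀ r, θ • Function.update x i r = Function.update (θ • x) i (θ * r) := fun r => by
      rw [← smul_eq_mul, Function.update_smul]
    simp_rw [h1]
    have hm : Measurable fun r => integrateOut s F (Function.update (θ • x) i r) :=
      (hF.lmarginal _).comp (measurable_update _)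
    rw [lintegral_const_mul' _ _ (ENNReal.pow_ne_top ENNReal.ofReal_ne_top),
      lintegral_halfLine_comp_mul hm hθ, Finset.card_insert_of_notMem hi]
    ring

section

variable {ι : Type*} [DecidableEq ι] {F : (ι → ℝ) → ℝ≥0∞}

theorem integrateOut_const_mul {c : ℝ≥0∞} (hc : c ≠ ∞) (s : Finset ι) (x : ι → ℝ) :
    integrateOut s (fun y => c * F y) x = c * integrateOut s F x :=
  lintegral_const_mul' _ _ hc

theorem IsLogConcaveAntitone.const_mul {ι : Type*} {F : (ι → ℝ) → ℝ≥0∞}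
    (hF : IsLogConcaveAntitone F) (c : ℝ≥0∞) :
    IsLogConcaveAntitone fun x => c * F x where
  measurable := hF.measurable.const_mul c
  antitone _ _ h := by have := hF.antitone h; dsimp only; gcongr
  sup_zero x := by simp only [hF.sup_zero]
  logConcave x y s t hs ht hst := by
    rw [ENNReal.mul_rpow_of_nonneg _ _ hs.le, ENNReal.mul_rpow_of_nonneg _ _ ht.le,
      mul_mul_mul_comm, ← ENNReal.rpow_add_of_nonneg _ _ hs.le ht.le, hst, ENNReal.rpow_one]
    gcongr
    exact hF.logConcave x y s t hs ht hst

/-- The Jacobian of scaling a `(k - 1)`-dimensional section by `(k - 1) / k`; it is the source of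
the factor `e` per coordinate. -/
theorem inv_one_sub_inv_pow_le_exp {k : ℕ} (hk : 2 ≤ k) :
    ((((k : ℝ) - 1) / k)⁻¹) ^ (k - 1) ≤ Real.exp 1 := by
  have hk' : (2 : ℝ) ≤ k := by exact_mod_cast hk
  have h1 : (((k : ℝ) - 1) / k)⁻¹ = 1 / (k - 1) + 1 := by
    have : (k : ℝ) - 1 ≠ 0 := by linarith
    field_simp
    ring
  rw [h1]
  have h0 : (0 : ℝ) ≤ 1 / (k - 1) := by apply one_div_nonneg.2; linarith
  calc (1 / ((k : ℝ) - 1) + 1) ^ (k - 1) ≤ Real.exp (1 / (k - 1)) ^ (k - 1) :=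
        pow_le_pow_left₀ (by linarith) (Real.add_one_le_exp _) _
    _ = Real.exp 1 := by
        rw [← Real.exp_nat_mul, Nat.cast_sub (by omega), Nat.cast_one,
          mul_one_div_cancel (by linarith)]

/-- Monotonicity bounds `F x` by the geometric mean of its values with one coordinate set to `0`,
with exponents `1 / k`, while Loomis–Whitney needs `1 / (k - 1)`. Contracting towards the origin by
`θ = (k - 1) / k` makes up the difference: `F ^ θ ≤ F (θ • ·)` because `F 0 = 1`. -/
theorem IsLogConcaveAntitone.pow_le_prod_of_zero_eq_one (hF : IsLogConcaveAntitone F)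
    (h0 : F 0 = 1) {S : Finset ι} (hS : 2 ≤ S.card) :
    _root_.integrateOut S F 0 ^ (S.card - 1)
      ≤ ENNReal.ofReal (Real.exp 1) ^ S.card
        * ∏ i ∈ S, _root_.integrateOut (S.erase i) F 0 := by
  set k := S.card with hk
  have hk' : (2 : ℝ) ≤ k := by exact_mod_cast hS
  set θ : ℝ := ((k : ℝ) - 1) / k with hθ
  have hθ0 : 0 < θ := div_pos (by linarith) (by linarith)
  have hθ1 : θ < 1 := (div_lt_one (by linarith)).2 (by linarith)
  have hq : (0 : ℝ) ≤ 1 / (k - 1) := by apply one_div_nonneg.2; linarith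
  have hmu : ∀ i : ι, Measurable fun x : ι → ℝ => F (Function.update x i 0) := fun i =>
    hF.measurable.comp measurable_update_left
  have hsm : ∀ (i : ι) (x : ι → ℝ),
      Function.update (θ • x) i 0 = θ • Function.update x i 0 := fun i x => by
    rw [← Function.update_smul, smul_zero]
  have hpt : ∀ x, F x ≤ ∏ i ∈ S, F (Function.update (θ • x) i 0) ^ (1 / ((k : ℝ) - 1)) := by
    intro x
    calc F x = ∏ _i ∈ S, F x ^ (1 / (k : ℝ)) := by
          rw [Finset.prod_const, ← hk, ← ENNReal.rpow_mul_natCast, one_div_mul_cancel (by linarith),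
            ENNReal.rpow_one]
      _ ≤ _ := by
          gcongr with i hi
          calc F x ^ (1 / (k : ℝ)) ≤ F (Function.update x i 0) ^ (1 / (k : ℝ)) := by
                gcongr; exact hF.le_update_zero x i
            _ = (F (Function.update x i 0) ^ θ) ^ (1 / ((k : ℝ) - 1)) := by
                rw [← ENNReal.rpow_mul, hθ]
                congr 1
                have : (k : ℝ) - 1 ≠ 0 := by linarith
                field_simp
            _ ≤ _ := by
                rw [hsm]
                gcongr
                exact hF.rpow_le_smul h0 _ hθ0 hθ1
  have hLW := lmarginal_prod_rpow_le (μ := fun _ : ι => halfLine) S (by omega)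
    (g := fun i x => F (Function.update (θ • x) i 0))
    (fun i => (hmu i).comp (measurable_const_smul θ))
    (fun i x r => by rw [hsm, hsm, Function.update_idem]) subset_rfl 0
  have h1 : _root_.integrateOut S F 0 ≤ ∏ i ∈ S,
      (_root_.integrateOut (S.erase i) (fun x => F (Function.update (θ • x) i 0)) 0)
        ^ (1 / ((k : ℝ) - 1)) :=
    (lmarginal_mono (fun x => hpt x) 0).trans hLW
  have h2 : ∀ i, _root_.integrateOut (S.erase i) (fun x => F (Function.update (θ • x) i 0)) 0
      = ENNReal.ofReal θ⁻¹ ^ (S.erase i).card * _root_.integrateOut (S.erase i) F 0 := by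
    intro i
    rw [integrateOut_comp_smul (hmu i) hθ0, smul_zero]
    congr 1
    have := lmarginal_update_of_notMem (μ := fun _ : ι => halfLine) hF.measurable
      (Finset.notMem_erase i S) 0 0
    rw [show Function.update (0 : ι → ℝ) i (0 : ℝ) = 0 from Function.update_eq_self i _] at this
    exact this.symm
  calc _root_.integrateOut S F 0 ^ (k - 1)
      ≤ (∏ i ∈ S, (_root_.integrateOut (S.erase i)
          (fun x => F (Function.update (θ • x) i 0)) 0) ^ (1 / ((k : ℝ) - 1))) ^ (k - 1) := by
        gcongr
    _ = ∏ i ∈ S, _root_.integrateOut (S.erase i)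
          (fun x => F (Function.update (θ • x) i 0)) 0 := by
        rw [← Finset.prod_pow]
        refine Finset.prod_congr rfl fun i _ => ?_
        rw [← ENNReal.rpow_mul_natCast, Nat.cast_sub (by omega), Nat.cast_one,
          one_div_mul_cancel (by linarith), ENNReal.rpow_one]
    _ ≤ ∏ i ∈ S, (ENNReal.ofReal (Real.exp 1) * _root_.integrateOut (S.erase i) F 0) := by
        gcongr with i hi
        rw [h2, Finset.card_erase_of_mem hi, ← hk, ← ENNReal.ofReal_pow (by positivity)]
        gcongr
        exact inv_one_sub_inv_pow_le_exp hS
    _ = _ := by rw [Finset.prod_mul_distrib, Finset.prod_const]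

/-- A functional Loomis–Whitney inequality for log-concave antitone functions, with the sections
through the origin in place of the projections. -/
theorem IsLogConcaveAntitone.zero_mul_pow_le (hF : IsLogConcaveAntitone F) {S : Finset ι}
    (hS : S.Nonempty) :
    F 0 * _root_.integrateOut S F 0 ^ (S.card - 1)
      ≤ ENNReal.ofReal (Real.exp 1) ^ S.card
        * ∏ i ∈ S, _root_.integrateOut (S.erase i) F 0 := by
  rcases (Nat.one_le_iff_ne_zero.2 hS.card_ne_zero).eq_or_lt with hk | hk
  · obtain ⟨i, rfl⟩ := Finset.card_eq_one.1 hk.symm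
    have : 1 ≤ ENNReal.ofReal (Real.exp 1) := by
      rw [ENNReal.one_le_ofReal]; exact Real.one_le_exp zero_le_one
    simpa using mul_le_mul_left this (F 0)
  -- Both sides are homogeneous of degree `|S|` in the function, so it may be normalised to be `1`
  -- at the origin.
  have fin : ∀ {G : (ι → ℝ) → ℝ≥0∞}, IsLogConcaveAntitone G → G 0 ≠ ∞ →
      G 0 * _root_.integrateOut S G 0 ^ (S.card - 1)
        ≤ ENNReal.ofReal (Real.exp 1) ^ S.card
          * ∏ i ∈ S, _root_.integrateOut (S.erase i) G 0 := by
    intro G hG h1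
    rcases eq_or_ne (G 0) 0 with h0 | h0
    · simp [h0]
    have hc : (G 0)⁻¹ ≠ ∞ := ENNReal.inv_ne_top.2 h0
    have := (hG.const_mul (G 0)⁻¹).pow_le_prod_of_zero_eq_one
      (ENNReal.inv_mul_cancel h0 h1) hk
    simp_rw [integrateOut_const_mul hc] at this
    rw [Finset.prod_mul_distrib, Finset.prod_const, mul_pow] at this
    have h2 := mul_le_mul_right this (G 0 ^ S.card)
    have h3 : G 0 ^ S.card * (G 0)⁻¹ ^ S.card = 1 := by
      rw [← mul_pow, ENNReal.mul_inv_cancel h0 h1, one_pow]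
    have h4 : G 0 ^ S.card * (G 0)⁻¹ ^ (S.card - 1) = G 0 := by
      obtain ⟨m, hm⟩ : ∃ m, S.card = m + 1 := ⟨S.card - 1, by omega⟩
      rw [hm, Nat.add_sub_cancel, pow_succ', mul_assoc, ← mul_pow, ENNReal.mul_inv_cancel h0 h1,
        one_pow, mul_one]
    calc _ = G 0 ^ S.card * ((G 0)⁻¹ ^ (S.card - 1)
          * _root_.integrateOut S G 0 ^ (S.card - 1)) := by rw [← mul_assoc, h4]
      _ ≤ _ := h2
      _ = (G 0 ^ S.card * (G 0)⁻¹ ^ S.card) * (ENNReal.ofReal (Real.exp 1) ^ S.card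
          * ∏ i ∈ S, _root_.integrateOut (S.erase i) G 0) := by ring
      _ = _ := by rw [h3, one_mul]
  rcases ne_or_eq (F 0) ∞ with h1 | h1
  · exact fin hF h1
  rcases eq_or_ne (_root_.integrateOut S F 0) 0 with hI | hI
  · rw [hI, zero_pow (by omega)]; simp
  -- An infinite value at the origin is reached as the limit of the truncations `min F N`.
  have lim : Filter.Tendsto (fun N : ℕ => min (F 0) N
      * _root_.integrateOut S (fun x => min (F x) N) 0 ^ (S.card - 1)) Filter.atTop
      (nhds (F 0 * _root_.integrateOut S F 0 ^ (S.card - 1))) := by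
    refine ENNReal.Tendsto.mul ?_ (Or.inl (by simp [h1])) ?_ (Or.inl (pow_ne_zero _ hI))
    · have := (tendsto_const_nhds (x := F 0)).min ENNReal.tendsto_nat_nhds_top
      simpa using this
    · refine ENNReal.Tendsto.pow ?_
      exact tendsto_lintegral_min_nat (hF.measurable.comp measurable_updateFinset)
  refine le_of_tendsto' lim fun N => ?_
  refine (fin (hF.min_const N) (by simp)).trans ?_
  gcongr with i hi
  exact lmarginal_mono (fun x => min_le_left _ _) 0

end

/-! ### Exponential tails in dimension one. -/

theorem lintegral_halfLine_eq_Ioi (ψ : ℝ → ℝ≥0∞) :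
    ∫⁻ r, ψ r ∂halfLine = ∫⁻ r in Set.Ioi 0, ψ r :=
  (setLIntegral_congr Ioi_ae_eq_Ici).symm

theorem setLIntegral_halfLine_Ioi (ψ : ℝ → ℝ≥0∞) {t : ℝ} (ht : 0 ≤ t) :
    ∫⁻ r in Set.Ioi t, ψ r ∂halfLine = ∫⁻ r in Set.Ioi t, ψ r := by
  rw [halfLine, Measure.restrict_restrict measurableSet_Ioi,
    Set.inter_eq_left.2 (Set.Ioi_subset_Ici ht)]

theorem setLIntegral_Ioi_split (ψ : ℝ → ℝ≥0∞) {a b : ℝ} (hab : a ≤ b) :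
    ∫⁻ r in Set.Ioi a, ψ r = (∫⁻ r in Set.Ioc a b, ψ r) + ∫⁻ r in Set.Ioi b, ψ r := by
  rw [← lintegral_union measurableSet_Ioi (Set.disjoint_left.2 fun r h1 h2 =>
    not_lt_of_ge h1.2 h2), Set.Ioc_union_Ioi_eq_Ioi hab]

theorem setLIntegral_add_right (ψ : ℝ → ℝ≥0∞) {A B : Set ℝ} (s : ℝ)
    (hA : MeasurableSet A) (hB : MeasurableSet B) (hAB : ∀ r, r ∈ A ↔ r + s ∈ B) :
    ∫⁻ r in A, ψ (r + s) = ∫⁻ r in B, ψ r := by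
  rw [← lintegral_indicator hA, ← lintegral_indicator hB,
    ← lintegral_add_right_eq_self (B.indicator ψ) s]
  refine lintegral_congr fun r => ?_
  by_cases h : r ∈ A
  · rw [Set.indicator_of_mem h, Set.indicator_of_mem ((hAB r).1 h)]
  · rw [Set.indicator_of_notMem h, Set.indicator_of_notMem (fun h' => h ((hAB r).2 h'))]

/-- The points `x` and `y + d` lie between `y` and `x + d` with interchanged weights; the two
log-concavity inequalities are multiplied. -/
theorem mul_le_mul_of_logConcave {ψ : ℝ → ℝ≥0∞}
    (hlc : ∀ s t : ℝ, 0 < s → 0 < t → s + t = 1 → ∀ a b, ψ a ^ s * ψ b ^ t ≤ ψ (s * a + t * b))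
    {x y d : ℝ} (hxy : y ≤ x) (hd : 0 ≤ d) : ψ (x + d) * ψ y ≤ ψ x * ψ (y + d) := by
  rcases hxy.eq_or_lt with rfl | hxy
  · rw [mul_comm]
  rcases hd.eq_or_lt with rfl | hd
  · simp
  have hL : 0 < x + d - y := by linarith
  have h1 : 0 < d / (x + d - y) := div_pos hd hL
  have h2 : 0 < (x - y) / (x + d - y) := div_pos (by linarith) hL
  have h12 : d / (x + d - y) + (x - y) / (x + d - y) = 1 := by
    rw [← add_div, div_eq_one_iff_eq hL.ne']; ring
  have e1 : d / (x + d - y) * y + (x - y) / (x + d - y) * (x + d) = x := by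
    field_simp; ring
  have e2 : (x - y) / (x + d - y) * y + d / (x + d - y) * (x + d) = y + d := by
    field_simp; ring
  have k1 := hlc _ _ h1 h2 h12 y (x + d)
  have k2 := hlc _ _ h2 h1 (by rw [add_comm, h12]) y (x + d)
  rw [e1] at k1
  rw [e2] at k2
  calc ψ (x + d) * ψ y
      = ψ (x + d) ^ (d / (x + d - y) + (x - y) / (x + d - y))
        * ψ y ^ (d / (x + d - y) + (x - y) / (x + d - y)) := by simp [h12]
    _ = ψ y ^ (d / (x + d - y)) * ψ (x + d) ^ ((x - y) / (x + d - y))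
        * (ψ y ^ ((x - y) / (x + d - y)) * ψ (x + d) ^ (d / (x + d - y))) := by
      rw [ENNReal.rpow_add_of_nonneg _ _ h1.le h2.le, ENNReal.rpow_add_of_nonneg _ _ h1.le h2.le]
      ring
    _ ≤ _ := mul_le_mul' k1 k2

/-- Splitting the integrals from `0` and from `s` at `t` and `s + t` leaves one pair of equal
products. The other pair is compared pointwise by `mul_le_mul_of_logConcave`, for `y ≤ t < x`. -/
theorem tail_mul_le {ψ : ℝ → ℝ≥0∞} (hψ : Antitone ψ)
    (hlc : ∀ s t : ℝ, 0 < s → 0 < t → s + t = 1 → ∀ a b, ψ a ^ s * ψ b ^ t ≤ ψ (s * a + t * b))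
    {s t : ℝ} (hs : 0 ≤ s) (ht : 0 ≤ t) :
    (∫⁻ r in Set.Ioi (s + t), ψ r) * (∫⁻ r in Set.Ioi 0, ψ r)
      ≤ (∫⁻ r in Set.Ioi t, ψ r) * ∫⁻ r in Set.Ioi s, ψ r := by
  have hm : Measurable ψ := hψ.measurable
  have e1 : ∫⁻ r in Set.Ioi t, ψ (r + s) = ∫⁻ r in Set.Ioi (s + t), ψ r :=
    setLIntegral_add_right ψ s measurableSet_Ioi measurableSet_Ioi fun r => by
      simp only [Set.mem_Ioi]; constructor <;> intro h <;> linarith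
  have e2 : ∫⁻ r in Set.Ioc 0 t, ψ (r + s) = ∫⁻ r in Set.Ioc s (s + t), ψ r :=
    setLIntegral_add_right ψ s measurableSet_Ioc measurableSet_Ioc fun r => by
      simp only [Set.mem_Ioc]; constructor <;> intro h <;> constructor <;> linarith [h.1, h.2]
  have key : (∫⁻ r in Set.Ioi (s + t), ψ r) * (∫⁻ r in Set.Ioc 0 t, ψ r)
      ≤ (∫⁻ r in Set.Ioi t, ψ r) * ∫⁻ r in Set.Ioc s (s + t), ψ r := by
    have hms : Measurable fun r => ψ (r + s) := hm.comp (measurable_add_const s)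
    rw [← e1, ← e2, ← lintegral_mul_const _ hms, ← lintegral_mul_const _ hm]
    refine setLIntegral_mono' measurableSet_Ioi fun x hx => ?_
    rw [← lintegral_const_mul _ hm, ← lintegral_const_mul _ hms]
    refine setLIntegral_mono' measurableSet_Ioc fun y hy => ?_
    exact mul_le_mul_of_logConcave hlc (hy.2.trans (le_of_lt hx)) hs
  rw [setLIntegral_Ioi_split ψ ht, setLIntegral_Ioi_split ψ (by linarith : s ≤ s + t), mul_add,
    mul_add]
  exact add_le_add key (le_of_eq (mul_comm _ _))

theorem tail_nat_mul_le {ψ : ℝ → ℝ≥0∞} (hψ : Antitone ψ)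
    (hlc : ∀ s t : ℝ, 0 < s → 0 < t → s + t = 1 → ∀ a b, ψ a ^ s * ψ b ^ t ≤ ψ (s * a + t * b))
    {d : ℝ} (hd : 0 ≤ d) {q : ℝ≥0∞} (hq : q ≠ 0)
    (h : ∫⁻ r in Set.Ioi d, ψ r ≤ q * ∫⁻ r in Set.Ioi 0, ψ r) (m : ℕ) :
    ∫⁻ r in Set.Ioi (m * d), ψ r ≤ q ^ m * ∫⁻ r in Set.Ioi 0, ψ r := by
  rcases eq_or_ne (∫⁻ r in Set.Ioi 0, ψ r) ∞ with hI | hI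
  · rw [hI, ENNReal.mul_top (pow_ne_zero _ hq)]; exact le_top
  rcases eq_or_ne (∫⁻ r in Set.Ioi 0, ψ r) 0 with h0 | h0
  · refine (lintegral_mono_set (Set.Ioi_subset_Ioi (by positivity))).trans ?_
    rw [h0]; exact zero_le
  induction m with
  | zero => simp
  | succ m ih =>
    have h1 := tail_mul_le hψ hlc (s := m * d) (t := d) (by positivity) hd
    have h2 : (∫⁻ r in Set.Ioi (m * d + d), ψ r) * (∫⁻ r in Set.Ioi 0, ψ r)
        ≤ q ^ (m + 1) * (∫⁻ r in Set.Ioi 0, ψ r) * ∫⁻ r in Set.Ioi 0, ψ r := by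
      refine h1.trans ((mul_le_mul' h ih).trans_eq ?_)
      ring
    rw [ENNReal.mul_le_mul_iff_left h0 hI] at h2
    rwa [show ((m + 1 : ℕ) : ℝ) * d = m * d + d by push_cast; ring]

/-- By Chebyshev at least `3 / 4` of the mass lies in `(0, 2M]`, and monotonicity puts at least the
fraction `d / (2M)` of that in `(0, d]`. What remains is `1 - 3d / (8M)`, at most its exponential
bound. -/
theorem tail_le_of_le_two_mul {ψ : ℝ → ℝ≥0∞} (hψ : Antitone ψ) {M d : ℝ} (hM : 0 < M)
    (hd : 0 < d) (hdM : d ≤ 2 * M)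
    (h2 : ∫⁻ r, ENNReal.ofReal (r ^ 2) * ψ r ∂halfLine
      ≤ ENNReal.ofReal (M ^ 2) * ∫⁻ r, ψ r ∂halfLine) :
    ∫⁻ r in Set.Ioi d, ψ r
      ≤ ENNReal.ofReal (Real.exp (-(3 / 8 * (d / M)))) * ∫⁻ r in Set.Ioi 0, ψ r := by
  have hm : Measurable ψ := hψ.measurable
  rw [lintegral_halfLine_eq_Ioi ψ] at h2
  rcases eq_or_ne (∫⁻ r in Set.Ioi 0, ψ r) ∞ with hI | hI
  · rw [hI, ENNReal.mul_top (by simp [Real.exp_pos])]; exact le_top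
  have s1 := setLIntegral_Ioi_split ψ hd.le
  have s2 := setLIntegral_Ioi_split ψ (by positivity : 0 ≤ 2 * M)
  have cheb : ENNReal.ofReal ((2 * M) ^ 2) * ∫⁻ r in Set.Ioi (2 * M), ψ r
      ≤ ENNReal.ofReal (M ^ 2) * ∫⁻ r in Set.Ioi 0, ψ r := by
    refine le_trans ?_ h2
    rw [← lintegral_const_mul _ hm, lintegral_halfLine_eq_Ioi]
    refine le_trans ?_ (lintegral_mono_set (Set.Ioi_subset_Ioi (by positivity : 0 ≤ 2 * M)))
    refine setLIntegral_mono' measurableSet_Ioi fun x hx => ?_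
    gcongr
    exact le_of_lt hx
  have scale : ENNReal.ofReal (d / (2 * M)) * ∫⁻ r in Set.Ioc 0 (2 * M), ψ r
      ≤ ∫⁻ r in Set.Ioc 0 d, ψ r := by
    have hθ : 0 < 2 * M / d := by positivity
    have := lintegral_halfLine_comp_mul (h := (Set.Ioc 0 (2 * M)).indicator ψ)
      (hm.indicator measurableSet_Ioc) hθ
    rw [inv_div] at this
    have e : ∀ (c : ℝ), ∫⁻ r, (Set.Ioc 0 c).indicator ψ r ∂halfLine
        = ∫⁻ r in Set.Ioc 0 c, ψ r := fun c => by
      rw [lintegral_indicator measurableSet_Ioc, halfLine,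
        Measure.restrict_restrict measurableSet_Ioc,
        Set.inter_eq_left.2 (Set.Ioc_subset_Icc_self.trans Set.Icc_subset_Ici_self)]
    rw [← e, ← e, ← this]
    refine lintegral_mono_ae ?_
    filter_upwards [ae_halfLine_nonneg] with r hr
    by_cases h : 2 * M / d * r ∈ Set.Ioc 0 (2 * M)
    · have hr' : r ∈ Set.Ioc 0 d := by
        refine ⟨(mul_pos_iff_of_pos_left hθ).1 h.1, ?_⟩
        have := h.2
        rw [div_mul_eq_mul_div, div_le_iff₀ hd] at this
        exact le_of_mul_le_mul_left this (by positivity)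
      rw [Set.indicator_of_mem h, Set.indicator_of_mem hr']
      exact hψ (le_mul_of_one_le_left hr ((one_le_div hd).2 hdM))
    · rw [Set.indicator_of_notMem h]; exact zero_le
  have f1 : ∫⁻ r in Set.Ioi d, ψ r ≠ ∞ :=
    ne_top_of_le_ne_top hI (lintegral_mono_set (Set.Ioi_subset_Ioi hd.le))
  have f2 : ∫⁻ r in Set.Ioi (2 * M), ψ r ≠ ∞ :=
    ne_top_of_le_ne_top hI (lintegral_mono_set (Set.Ioi_subset_Ioi (by positivity)))
  have f3 : ∫⁻ r in Set.Ioc 0 d, ψ r ≠ ∞ := ne_top_of_le_ne_top hI (s1 ▸ le_self_add)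
  have f4 : ∫⁻ r in Set.Ioc 0 (2 * M), ψ r ≠ ∞ := ne_top_of_le_ne_top hI (s2 ▸ le_self_add)
  generalize (∫⁻ r in Set.Ioi 0, ψ r) = I at *
  generalize (∫⁻ r in Set.Ioi d, ψ r) = a at *
  generalize (∫⁻ r in Set.Ioi (2 * M), ψ r) = b at *
  generalize (∫⁻ r in Set.Ioc 0 d, ψ r) = u at *
  generalize (∫⁻ r in Set.Ioc 0 (2 * M), ψ r) = v at *
  lift I to NNReal using hI
  lift a to NNReal using f1
  lift b to NNReal using f2
  lift u to NNReal using f3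
  lift v to NNReal using f4
  have conv : ∀ (c : ℝ), 0 ≤ c → ∀ (x y : NNReal),
      ENNReal.ofReal c * x ≤ y ↔ c * x ≤ y := fun c hc x y => by
    rw [ENNReal.ofReal, ← ENNReal.coe_mul, ENNReal.coe_le_coe, ← NNReal.coe_le_coe,
      NNReal.coe_mul, Real.coe_toNNReal _ hc]
  have conv' : ∀ (c : ℝ), 0 ≤ c → ∀ (x y : NNReal),
      (y : ℝ≥0∞) ≤ ENNReal.ofReal c * x ↔ (y : ℝ) ≤ c * x := fun c hc x y => by
    rw [ENNReal.ofReal, ← ENNReal.coe_mul, ENNReal.coe_le_coe, ← NNReal.coe_le_coe,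
      NNReal.coe_mul, Real.coe_toNNReal _ hc]
  rw [conv' _ (Real.exp_pos _).le]
  rw [conv _ (by positivity)] at scale
  have cheb' : 4 * (b : ℝ) ≤ I := by
    rw [ENNReal.ofReal, ENNReal.ofReal, ← ENNReal.coe_mul, ← ENNReal.coe_mul, ENNReal.coe_le_coe,
      ← NNReal.coe_le_coe, NNReal.coe_mul, NNReal.coe_mul, Real.coe_toNNReal _ (by positivity),
      Real.coe_toNNReal _ (by positivity)] at cheb
    have : M ^ 2 * (4 * (b : ℝ)) ≤ M ^ 2 * I := by linarith
    exact le_of_mul_le_mul_left this (by positivity)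
  have s1' : (I : ℝ) = u + a := by exact_mod_cast s1
  have s2' : (I : ℝ) = v + b := by exact_mod_cast s2
  have hv : 3 / 4 * (I : ℝ) ≤ v := by linarith
  have hu : 3 / 8 * (d / M) * (I : ℝ) ≤ u := by
    refine le_trans ?_ scale
    calc 3 / 8 * (d / M) * (I : ℝ) = d / (2 * M) * (3 / 4 * I) := by field_simp; ring
      _ ≤ _ := by gcongr
  have := Real.add_one_le_exp (-(3 / 8 * (d / M)))
  calc (a : ℝ) ≤ (-(3 / 8 * (d / M)) + 1) * I := by linarith
    _ ≤ _ := by gcongr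

/-- A log-concave antitone function on `[0,∞)` with second moment at most `M ^ 2` (relative to its
mass) has an exponential tail of rate `3 / (8 M)`. -/
theorem tail_le_exp {ψ : ℝ → ℝ≥0∞} (hψ : Antitone ψ)
    (hlc : ∀ s t : ℝ, 0 < s → 0 < t → s + t = 1 → ∀ a b, ψ a ^ s * ψ b ^ t ≤ ψ (s * a + t * b))
    {M p : ℝ} (hM : 0 < M) (hp : 0 < p)
    (h2 : ∫⁻ r, ENNReal.ofReal (r ^ 2) * ψ r ∂halfLine
      ≤ ENNReal.ofReal (M ^ 2) * ∫⁻ r, ψ r ∂halfLine) :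
    ∫⁻ r in Set.Ioi p, ψ r ∂halfLine
      ≤ ENNReal.ofReal (Real.exp (-(3 / 8 * (p / M)))) * ∫⁻ r, ψ r ∂halfLine := by
  rw [setLIntegral_halfLine_Ioi _ hp.le]
  -- Cutting `p` into `m` steps of length at most `2M` brings each step into the range of
  -- `tail_le_of_le_two_mul`; the rates add up to one independent of `m`.
  obtain ⟨m, hm⟩ := exists_nat_gt (p / (2 * M))
  have hm0 : (0 : ℝ) < m := lt_trans (by positivity) hm
  have hd : p / m ≤ 2 * M := by
    rw [div_lt_iff₀ (by positivity)] at hm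
    rw [div_le_iff₀ hm0]
    linarith
  have h := tail_nat_mul_le hψ hlc (div_pos hp hm0).le (by simp [Real.exp_pos])
    (tail_le_of_le_two_mul hψ hM (div_pos hp hm0) hd h2) m
  rw [mul_div_cancel₀ _ hm0.ne', ← ENNReal.ofReal_pow (Real.exp_pos _).le, ← Real.exp_nat_mul] at h
  rw [lintegral_halfLine_eq_Ioi]
  convert h using 4
  field_simp

/-! ### The value of a one-dimensional density at the origin. -/

/-- If `ψ 0 = ∞` and `ψ t > 0`, log-concavity makes `ψ (t / 2)` infinite, hence `ψ` is infinite on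
all of `(0, t / 2]`. -/
theorem zero_ne_top_of_lintegral_eq_one {ψ : ℝ → ℝ≥0∞} (hψ : Antitone ψ)
    (hlc : ∀ s t : ℝ, 0 < s → 0 < t → s + t = 1 → ∀ a b, ψ a ^ s * ψ b ^ t ≤ ψ (s * a + t * b))
    (h1 : ∫⁻ r, ψ r ∂halfLine = 1) : ψ 0 ≠ ∞ := by
  intro h0
  rw [lintegral_halfLine_eq_Ioi] at h1
  obtain ⟨t, ht, hψt⟩ : ∃ t > 0, ψ t ≠ 0 := by
    by_contra! h
    rw [setLIntegral_congr_fun measurableSet_Ioi (g := fun _ => 0) (fun t ht => h t ht)] at h1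
    simp at h1
  have htop : ψ (t / 2) = ∞ := by
    have := hlc (1 / 2) (1 / 2) (by norm_num) (by norm_num) (by norm_num) 0 t
    rw [h0, ENNReal.top_rpow_of_pos (by norm_num), ENNReal.top_mul (by simp [hψt])] at this
    rw [show (1 : ℝ) / 2 * 0 + 1 / 2 * t = t / 2 by ring] at this
    exact top_le_iff.1 this
  have : ∫⁻ r in Set.Ioc 0 (t / 2), ψ r = ∞ := by
    refine top_le_iff.1 (le_trans ?_ (setLIntegral_mono' measurableSet_Ioc
      (f := fun _ => ∞) (fun r hr => htop ▸ hψ hr.2)))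
    rw [setLIntegral_const, Real.volume_Ioc, ENNReal.top_mul]
    simpa using ht
  rw [setLIntegral_Ioi_split ψ (by positivity : 0 ≤ t / 2), this] at h1
  simp at h1

/-- Unit mass forces `ψ` to have dropped by a factor `e` at `t₁ = e / a`. Log-concavity propagates
this rate beyond `t₁`; before `t₁` the extra factor `e` in the bound compensates. -/
theorem le_exp_of_lintegral_eq_one {ψ : ℝ → ℝ≥0∞} (hψ : Antitone ψ)
    (hlc : ∀ s t : ℝ, 0 < s → 0 < t → s + t = 1 → ∀ a b, ψ a ^ s * ψ b ^ t ≤ ψ (s * a + t * b))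
    (h1 : ∫⁻ r, ψ r ∂halfLine = 1) {a : ℝ} (ha : 0 < a) (ha0 : ψ 0 = ENNReal.ofReal a) {t : ℝ}
    (ht : 0 ≤ t) :
    ψ t ≤ ENNReal.ofReal (a * Real.exp 1 * Real.exp (-(a / Real.exp 1 * t))) := by
  have he : 0 < Real.exp 1 := Real.exp_pos 1
  set t₁ := Real.exp 1 / a with ht₁
  have ht₁0 : 0 < t₁ := by positivity
  have hψt₁ : ENNReal.ofReal t₁ * ψ t₁ ≤ 1 := by
    rw [← h1, lintegral_halfLine_eq_Ioi]
    calc ENNReal.ofReal t₁ * ψ t₁ = ∫⁻ _r in Set.Ioc 0 t₁, ψ t₁ := by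
          rw [setLIntegral_const, Real.volume_Ioc, sub_zero, mul_comm]
      _ ≤ ∫⁻ r in Set.Ioc 0 t₁, ψ r :=
          setLIntegral_mono' measurableSet_Ioc fun r hr => hψ hr.2
      _ ≤ _ := lintegral_mono_set Set.Ioc_subset_Ioi_self
  rcases le_or_gt t t₁ with h | h
  · refine (hψ ht).trans (ha0.trans_le (ENNReal.ofReal_le_ofReal ?_))
    rw [mul_assoc, ← Real.exp_add]
    refine le_mul_of_one_le_right ha.le (Real.one_le_exp ?_)
    have : a / Real.exp 1 * t ≤ a / Real.exp 1 * t₁ := by gcongr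
    have h2 : a / Real.exp 1 * t₁ = 1 := by rw [ht₁]; field_simp
    linarith
  · have htpos : 0 < t := ht₁0.trans h
    have fin : ψ t ≠ ∞ := ne_top_of_le_ne_top (ha0 ▸ ENNReal.ofReal_ne_top) (hψ ht)
    obtain ⟨b, hb0, hb⟩ : ∃ b : ℝ, 0 ≤ b ∧ ψ t = ENNReal.ofReal b :=
      ⟨_, ENNReal.toReal_nonneg, (ENNReal.ofReal_toReal fin).symm⟩
    have hθ : 0 < t₁ / t := by positivity
    have hθ1 : t₁ / t < 1 := (div_lt_one htpos).2 h
    have key := hlc (1 - t₁ / t) (t₁ / t) (by linarith) hθ (by ring) 0 t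
    rw [mul_zero, zero_add, div_mul_cancel₀ _ htpos.ne', ha0, hb,
      ENNReal.ofReal_rpow_of_nonneg ha.le (by linarith), ENNReal.ofReal_rpow_of_nonneg hb0 hθ.le,
      ← ENNReal.ofReal_mul (by positivity)] at key
    have key2 : ENNReal.ofReal (t₁ * (a ^ (1 - t₁ / t) * b ^ (t₁ / t))) ≤ 1 := by
      rw [ENNReal.ofReal_mul ht₁0.le]
      exact (mul_le_mul' le_rfl key).trans hψt₁
    rw [ENNReal.ofReal_le_one, Real.rpow_sub ha, Real.rpow_one] at key2
    have key3 : (b / a) ^ (t₁ / t) ≤ Real.exp (-1) := by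
      rw [Real.div_rpow hb0 ha.le, Real.exp_neg]
      have : t₁ * (a / a ^ (t₁ / t) * b ^ (t₁ / t))
          = Real.exp 1 * (b ^ (t₁ / t) / a ^ (t₁ / t)) := by rw [ht₁]; field_simp
      rw [this] at key2
      rwa [← one_div, le_div_iff₀ he, mul_comm]
    have key4 : b / a ≤ Real.exp (-(a / Real.exp 1 * t)) := by
      have := Real.rpow_le_rpow (by positivity) key3 (by positivity : 0 ≤ t / t₁)
      rw [← Real.rpow_mul (by positivity), ← Real.exp_mul,
        show t₁ / t * (t / t₁) = 1 by field_simp, Real.rpow_one] at this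
      convert this using 2
      rw [ht₁]; field_simp
    rw [hb]
    refine ENNReal.ofReal_le_ofReal ?_
    rw [div_le_iff₀ ha] at key4
    calc b ≤ a * Real.exp (-(a / Real.exp 1 * t)) := by rw [mul_comm]; exact key4
      _ ≤ a * Real.exp 1 * Real.exp (-(a / Real.exp 1 * t)) := by
          gcongr
          exact le_mul_of_one_le_right ha.le (Real.one_le_exp zero_le_one)

theorem lintegral_sq_mul_exp {c : ℝ} (hc : 0 < c) :
    ∫⁻ r, ENNReal.ofReal (r ^ 2 * Real.exp (-(c * r))) ∂halfLine
      = ENNReal.ofReal (2 / c ^ 3) := by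
  -- The integral is the normalising constant of the Gamma density of shape `3` and rate `c`.
  have h := ProbabilityTheory.lintegral_gammaPDF_eq_one (a := 3) (by norm_num) hc
  have h2 : ∫⁻ r, ProbabilityTheory.gammaPDF 3 c r
      = ENNReal.ofReal (c ^ 3 / 2)
        * ∫⁻ r, ENNReal.ofReal (r ^ 2 * Real.exp (-(c * r))) ∂halfLine := by
    rw [← lintegral_const_mul' _ _ ENNReal.ofReal_ne_top, halfLine,
      ← lintegral_indicator measurableSet_Ici]
    refine lintegral_congr fun r => ?_
    by_cases hr : r ∈ Set.Ici (0 : ℝ)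
    · rw [Set.indicator_of_mem hr, ProbabilityTheory.gammaPDF_of_nonneg hr,
        ← ENNReal.ofReal_mul (by positivity)]
      congr 1
      have : Real.Gamma 3 = 2 := by
        have := Real.Gamma_nat_eq_factorial 2
        rw [show ((2 : ℕ) : ℝ) + 1 = 3 by norm_num] at this
        rw [this]
        norm_num
      rw [this, show (3 : ℝ) - 1 = (2 : ℕ) by norm_num, Real.rpow_natCast,
        show (3 : ℝ) = (3 : ℕ) by norm_num, Real.rpow_natCast]
      ring
    · rw [Set.indicator_of_notMem hr, ProbabilityTheory.gammaPDF_of_neg (not_le.1 hr)]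
  rw [h2] at h
  rw [eq_comm, ← mul_one (ENNReal.ofReal (2 / c ^ 3)), ← h, ← mul_assoc,
    ← ENNReal.ofReal_mul (by positivity), show 2 / c ^ 3 * (c ^ 3 / 2) = 1 by field_simp]
  simp

theorem zero_le_of_secondMoment {ψ : ℝ → ℝ≥0∞} (hψ : Antitone ψ)
    (hlc : ∀ s t : ℝ, 0 < s → 0 < t → s + t = 1 → ∀ a b, ψ a ^ s * ψ b ^ t ≤ ψ (s * a + t * b))
    (h1 : ∫⁻ r, ψ r ∂halfLine = 1) {σ : ℝ} (hσ : 0 < σ)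
    (h2 : ENNReal.ofReal (σ ^ 2) ≤ ∫⁻ r, ENNReal.ofReal (r ^ 2) * ψ r ∂halfLine) :
    ψ 0 ≤ ENNReal.ofReal (12 / σ) := by
  have hfin := zero_ne_top_of_lintegral_eq_one hψ hlc h1
  have hne : ψ 0 ≠ 0 := by
    intro h0
    have := lintegral_halfLine_min_eq hψ h0.le
    rw [h1] at this
    simp at this
  have ha : 0 < (ψ 0).toReal := ENNReal.toReal_pos hne hfin
  have ha0 := (ENNReal.ofReal_toReal hfin).symm
  set a := (ψ 0).toReal
  have he : 0 < Real.exp 1 := Real.exp_pos 1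
  rw [ha0]
  refine ENNReal.ofReal_le_ofReal ?_
  -- The second moment of the exponential majorant; it gives `a σ ≤ √2 e ^ 2`, and `12` is a
  -- convenient bound for `√2 e ^ 2`.
  have h3 : ENNReal.ofReal (σ ^ 2) ≤ ENNReal.ofReal (2 * Real.exp 1 ^ 4 / a ^ 2) := by
    refine h2.trans ?_
    calc ∫⁻ r, ENNReal.ofReal (r ^ 2) * ψ r ∂halfLine
        ≤ ∫⁻ r, ENNReal.ofReal (a * Real.exp 1)
          * ENNReal.ofReal (r ^ 2 * Real.exp (-(a / Real.exp 1 * r))) ∂halfLine := by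
          refine lintegral_mono_ae ?_
          filter_upwards [ae_halfLine_nonneg] with r hr
          refine (mul_le_mul' le_rfl
            (le_exp_of_lintegral_eq_one hψ hlc h1 ha ha0 hr)).trans_eq ?_
          rw [← ENNReal.ofReal_mul (by positivity), ← ENNReal.ofReal_mul (by positivity)]
          congr 1
          ring
      _ = _ := by
          rw [lintegral_const_mul' _ _ ENNReal.ofReal_ne_top,
            lintegral_sq_mul_exp (by positivity), ← ENNReal.ofReal_mul (by positivity)]
          congr 1
          field_simp
  rw [ENNReal.ofReal_le_ofReal_iff (by positivity), le_div_iff₀ (by positivity)] at h3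
  have h4 : 2 * Real.exp 1 ^ 4 ≤ 144 := by
    have h5 : Real.exp 1 < 2.72 := Real.exp_one_lt_d9.trans (by norm_num)
    have h6 : Real.exp 1 ^ 2 ≤ 8 := by nlinarith
    nlinarith
  rw [le_div_iff₀ hσ]
  nlinarith [mul_pos ha hσ]

/-! ### Joint bounds for small and large coordinates. -/

section Marginals

variable {ι : Type*} [DecidableEq ι] {F : (ι → ℝ) → ℝ≥0∞}

theorem integrateOut_mul_left {s : Finset ι} (hF : Measurable F) {A : (ι → ℝ) → ℝ≥0∞}
    (hA : ∀ x y, (∀ i ∉ s, x i = y i) → A x = A y) (x : ι → ℝ) :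
    integrateOut s (fun y => A y * F y) x = A x * integrateOut s F x := by
  rw [integrateOut, integrateOut, lmarginal, lmarginal,
    ← lintegral_const_mul (f := fun y => F (Function.updateFinset x s y)) _
      (hF.comp measurable_updateFinset)]
  refine lintegral_congr fun y => ?_
  congr 1
  refine hA _ _ fun i hi => ?_
  simp [Function.updateFinset, hi]

theorem integrateOut_union {s t : Finset ι} (hF : Measurable F) (hst : Disjoint s t) :
    integrateOut (s ∪ t) F = integrateOut s (integrateOut t F) :=
  lmarginal_union _ F hF hst

theorem integrateOut_prod_indicator (S : Finset ι) {B : Set ℝ} (hB : MeasurableSet B)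
    (x : ι → ℝ) :
    integrateOut S (fun y => ∏ i ∈ S, B.indicator 1 (y i)) x = halfLine B ^ S.card := by
  have hB' : Measurable (B.indicator (1 : ℝ → ℝ≥0∞)) := measurable_one.indicator hB
  have hm : ∀ S : Finset ι, Measurable fun y : ι → ℝ => ∏ i ∈ S, B.indicator (1 : ℝ → ℝ≥0∞) (y i) :=
    fun S => Finset.measurable_fun_prod _ fun i _ => hB'.comp (measurable_pi_apply i)
  induction S using Finset.induction_on generalizing x with
  | empty => simp
  | insert i S hi ih =>
    rw [integrateOut_insert (hm _) hi]
    simp_rw [Finset.prod_insert hi]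
    have : ∀ r, integrateOut S (fun y => B.indicator 1 (y i) * ∏ j ∈ S, B.indicator 1 (y j))
        (Function.update x i r) = B.indicator 1 r * halfLine B ^ S.card := fun r => by
      rw [integrateOut_mul_left (A := fun y => B.indicator 1 (y i)) (hm S)
        (fun y z h => by simp only [h i hi]), ih, Function.update_self]
    simp_rw [this]
    rw [lintegral_mul_const _ hB', lintegral_indicator_one hB, Finset.card_insert_of_notMem hi,
      pow_succ']

variable [Fintype ι]

theorem lintegral_mul_eq_integrateOut (hF : Measurable F) {A : (ι → ℝ) → ℝ≥0∞}
    (hAm : Measurable A) (S : Finset ι) (hA : ∀ x y, (∀ i ∈ S, x i = y i) → A x = A y) :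
    ∫⁻ x, A x * F x ∂Measure.pi (fun _ : ι => halfLine)
      = integrateOut S (fun x => A x * integrateOut Sᶜ F x) 0 := by
  rw [lintegral_eq_lmarginal_univ (μ := fun _ : ι => halfLine) 0, ← Finset.union_compl S]
  refine (congrFun (integrateOut_union (hAm.mul hF) disjoint_compl_right) 0).trans ?_
  congr 1
  ext x
  exact integrateOut_mul_left hF (fun x y h => hA x y fun i hi => h i (by simpa using hi)) x

theorem integrateOut_compl_eq_lintegral {e : ι} {U : Finset ι} (he : e ∉ U)
    (hF : Measurable F) (x : ι → ℝ) :
    integrateOut Uᶜ F x = ∫⁻ r, integrateOut (insert e U)ᶜ F (Function.update x e r) ∂halfLine := by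
  have : Uᶜ = insert e (insert e U)ᶜ := by
    ext i; simp only [Finset.mem_compl, Finset.mem_insert]
    by_cases h : i = e
    · subst h; simp [he]
    · simp [h]
  conv_lhs => rw [this]
  exact integrateOut_insert hF (by simp) x

theorem integrateOut_compl_mul_eq_lintegral {e : ι} {U : Finset ι} (he : e ∉ U)
    (hF : Measurable F) {k : ℝ → ℝ≥0∞} (hk : Measurable k) (x : ι → ℝ) :
    integrateOut Uᶜ (fun y => k (y e) * F y) x
      = ∫⁻ r, k r * integrateOut (insert e U)ᶜ F (Function.update x e r) ∂halfLine := by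
  rw [integrateOut_compl_eq_lintegral (F := fun y => k (y e) * F y) he
    ((hk.comp (measurable_pi_apply e)).mul hF)]
  refine lintegral_congr fun r => ?_
  rw [integrateOut_mul_left (A := fun y => k (y e)) hF (fun y z h => by
    simp only [h e (by simp)]), Function.update_self]

theorem integrateOut_univ_eq (x : ι → ℝ) :
    integrateOut Finset.univ F x = ∫⁻ x, F x ∂Measure.pi (fun _ : ι => halfLine) := by
  simp [integrateOut]

theorem lintegral_coord_mul (e : ι) (hF : Measurable F) {k : ℝ → ℝ≥0∞} (hk : Measurable k) :
    ∫⁻ x, k (x e) * F x ∂Measure.pi (fun _ : ι => halfLine)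
      = ∫⁻ r, k r * integrateOut {e}ᶜ F (Function.update 0 e r) ∂halfLine := by
  rw [← integrateOut_univ_eq 0, ← Finset.compl_empty,
    integrateOut_compl_mul_eq_lintegral (Finset.notMem_empty e) hF hk]
  simp

/-- If every coordinate in `S` has second moment at least `σ ^ 2`, all of them are at most `p` with
probability at most `(12 e p / σ) ^ |S|`. -/
theorem IsLogConcaveAntitone.lintegral_box_le (hF : IsLogConcaveAntitone F)
    (h1 : ∫⁻ x, F x ∂Measure.pi (fun _ : ι => halfLine) = 1) {S : Finset ι} (hS : S.Nonempty)
    {σ p : ℝ} (hσ : 0 < σ) (hp : 0 < p)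
    (h2 : ∀ i ∈ S, ENNReal.ofReal (σ ^ 2)
      ≤ ∫⁻ x, ENNReal.ofReal (x i ^ 2) * F x ∂Measure.pi (fun _ : ι => halfLine)) :
    ∫⁻ x, (∏ i ∈ S, (Set.Iic p).indicator 1 (x i)) * F x ∂Measure.pi (fun _ : ι => halfLine)
      ≤ ENNReal.ofReal (12 * Real.exp 1 * p / σ) ^ S.card := by
  have hm : Measurable fun y : ι → ℝ => ∏ i ∈ S, (Set.Iic p).indicator (1 : ℝ → ℝ≥0∞) (y i) :=
    Finset.measurable_fun_prod _ fun i _ =>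
      (measurable_one.indicator measurableSet_Iic).comp (measurable_pi_apply i)
  have hG := hF.integrateOut Sᶜ
  have hmass : _root_.integrateOut S (_root_.integrateOut Sᶜ F) 0 = 1 := by
    rw [← integrateOut_union hF.measurable disjoint_compl_right, Finset.union_compl,
      integrateOut_univ_eq, h1]
  have hLW := hG.zero_mul_pow_le hS
  rw [hmass, one_pow, mul_one] at hLW
  -- The section of the marginal of `S` obtained by fixing coordinate `i` at `0` integrates to the
  -- marginal density of coordinate `i` at `0`.
  have hsec : ∀ i ∈ S, _root_.integrateOut (S.erase i) (_root_.integrateOut Sᶜ F) 0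
      ≤ ENNReal.ofReal (12 / σ) := by
    intro i hi
    have hun : S.erase i ∪ Sᶜ = {i}ᶜ := by
      ext j
      simp only [Finset.mem_union, Finset.mem_erase, Finset.mem_compl, Finset.mem_singleton]
      by_cases hj : j ∈ S
      · simp [hj]
      · simp only [hj, and_false, not_false_eq_true, or_true, true_iff]
        rintro rfl; exact hj hi
    rw [← integrateOut_union hF.measurable
      (disjoint_compl_right.mono_left (Finset.erase_subset i S)), hun]
    have hφ := hF.integrateOut {i}ᶜ
    have := zero_le_of_secondMoment (hφ.slice_antitone 0 i)
      (fun s t hs ht hst a b => hφ.slice_logConcave 0 i hs ht hst a b)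
      (by
        have := lintegral_coord_mul i hF.measurable (k := fun _ => 1) measurable_const
        simp only [one_mul] at this
        rw [← this, h1])
      hσ (by
        rw [← lintegral_coord_mul i hF.measurable (k := fun r => ENNReal.ofReal (r ^ 2))
          (by fun_prop)]
        exact h2 i hi)
    rwa [show Function.update (0 : ι → ℝ) i (0 : ℝ) = 0 from Function.update_eq_self i _] at this
  calc ∫⁻ x, (∏ i ∈ S, (Set.Iic p).indicator 1 (x i)) * F x ∂Measure.pi (fun _ : ι => halfLine)
      = _root_.integrateOut S (fun x => (∏ i ∈ S, (Set.Iic p).indicator 1 (x i))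
          * _root_.integrateOut Sᶜ F x) 0 :=
        lintegral_mul_eq_integrateOut hF.measurable hm S fun x y h =>
          Finset.prod_congr rfl fun i hi => by rw [h i hi]
    _ ≤ _root_.integrateOut S (fun x => (∏ i ∈ S, (Set.Iic p).indicator 1 (x i))
          * _root_.integrateOut Sᶜ F 0) 0 := by
        refine lmarginal_mono (fun x => ?_) 0
        exact mul_le_mul' le_rfl (hG.le_zero x)
    _ = ENNReal.ofReal p ^ S.card * _root_.integrateOut Sᶜ F 0 := by
        have := lintegral_mul_const (μ := Measure.pi fun _ : S => halfLine)
          (_root_.integrateOut Sᶜ F 0) (hm.comp (measurable_updateFinset (x := (0 : ι → ℝ))))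
        refine this.trans ?_
        congr 1
        refine (integrateOut_prod_indicator S measurableSet_Iic 0).trans ?_
        rw [halfLine, Measure.restrict_apply measurableSet_Iic, Set.inter_comm, Set.Ici_inter_Iic,
          Real.volume_Icc, sub_zero]
    _ ≤ ENNReal.ofReal p ^ S.card * (ENNReal.ofReal (Real.exp 1) ^ S.card
          * ENNReal.ofReal (12 / σ) ^ S.card) := by
        gcongr
        refine hLW.trans ?_
        rw [← Finset.prod_const (s := S) (ENNReal.ofReal (12 / σ))]
        gcongr with i hi
        exact hsec i hi
    _ = _ := by
        rw [← mul_pow, ← mul_pow, ← ENNReal.ofReal_mul (Real.exp_pos 1).le,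
          ← ENNReal.ofReal_mul hp.le]
        congr 2
        ring

/-- If conditionally on any nonempty set of coordinates each other coordinate has second moment at
most `M ^ 2`, then each further requirement `p < x e` costs a factor `exp (-3 p / (8 M))`. -/
theorem IsLogConcaveAntitone.lintegral_tail_le (hF : IsLogConcaveAntitone F) {M p : ℝ}
    (hM : 0 < M) (hp : 0 < p)
    (h2 : ∀ U : Finset ι, U.Nonempty → ∀ e ∉ U, ∀ x : ι → ℝ,
      ∫⁻ r, ENNReal.ofReal (r ^ 2)
          * _root_.integrateOut (insert e U)ᶜ F (Function.update x e r) ∂halfLine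
        ≤ ENNReal.ofReal (M ^ 2) * _root_.integrateOut Uᶜ F x)
    {S : Finset ι} (hS : S.Nonempty) {A : (ι → ℝ) → ℝ≥0∞} (hAm : Measurable A)
    (hA : ∀ x y, (∀ i ∈ S, x i = y i) → A x = A y) {T : Finset ι} (hST : Disjoint S T) :
    ∫⁻ x, (A x * ∏ i ∈ T, (Set.Ioi p).indicator 1 (x i)) * F x ∂Measure.pi (fun _ : ι => halfLine)
      ≤ ENNReal.ofReal (Real.exp (-(3 / 8 * (p / M)))) ^ T.card
        * ∫⁻ x, A x * F x ∂Measure.pi (fun _ : ι => halfLine) := by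
  have hI : Measurable ((Set.Ioi p).indicator (1 : ℝ → ℝ≥0∞)) :=
    measurable_one.indicator measurableSet_Ioi
  have hm : ∀ T : Finset ι,
      Measurable fun y : ι → ℝ => ∏ i ∈ T, (Set.Ioi p).indicator (1 : ℝ → ℝ≥0∞) (y i) :=
    fun T => Finset.measurable_fun_prod _ fun i _ => hI.comp (measurable_pi_apply i)
  induction T using Finset.induction_on with
  | empty => simp
  | insert e T he ih =>
    rw [Finset.disjoint_insert_right] at hST
    have heU : e ∉ S ∪ T := by simp [hST.1, he]
    set B : (ι → ℝ) → ℝ≥0∞ := fun x => A x * ∏ i ∈ T, (Set.Ioi p).indicator 1 (x i) with hB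
    have hBm : Measurable B := hAm.mul (hm T)
    have hBd : ∀ x y, (∀ i ∈ S ∪ T, x i = y i) → B x = B y := fun x y h => by
      rw [hB]
      simp only
      rw [hA x y fun i hi => h i (Finset.mem_union_left _ hi)]
      congr 1
      exact Finset.prod_congr rfl fun i hi => by rw [h i (Finset.mem_union_right _ hi)]
    calc ∫⁻ x, (A x * ∏ i ∈ insert e T, (Set.Ioi p).indicator 1 (x i)) * F x
          ∂Measure.pi (fun _ : ι => halfLine)
        = ∫⁻ x, B x * ((Set.Ioi p).indicator 1 (x e) * F x)
          ∂Measure.pi (fun _ : ι => halfLine) := by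
          refine lintegral_congr fun x => ?_
          rw [Finset.prod_insert he, hB]
          ring
      _ = _root_.integrateOut (S ∪ T) (fun x => B x * _root_.integrateOut (S ∪ T)ᶜ
            (fun y => (Set.Ioi p).indicator 1 (y e) * F y) x) 0 :=
          lintegral_mul_eq_integrateOut ((hI.comp (measurable_pi_apply e)).mul hF.measurable)
            hBm _ hBd
      _ ≤ _root_.integrateOut (S ∪ T)
            (fun x => ENNReal.ofReal (Real.exp (-(3 / 8 * (p / M))))
              * (B x * _root_.integrateOut (S ∪ T)ᶜ F x)) 0 := by
          refine lmarginal_mono (fun x => ?_) 0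
          simp only
          rw [mul_left_comm]
          refine mul_le_mul' le_rfl ?_
          -- With the coordinates of `S ∪ T` fixed, only the unnormalised conditional density of
          -- coordinate `e` matters; the conditioning set is nonempty because `S` is.
          rw [integrateOut_compl_mul_eq_lintegral heU hF.measurable hI,
            integrateOut_compl_eq_lintegral heU hF.measurable]
          have hφ := hF.integrateOut (insert e (S ∪ T))ᶜ
          have := tail_le_exp (hφ.slice_antitone x e)
            (fun s t hs ht hst a b => hφ.slice_logConcave x e hs ht hst a b) hM hp (by
              rw [← integrateOut_compl_eq_lintegral heU hF.measurable]
              exact h2 _ (hS.mono Finset.subset_union_left) e heU x)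
          refine le_trans (le_of_eq ?_) this
          rw [← lintegral_indicator measurableSet_Ioi]
          refine lintegral_congr fun r => ?_
          by_cases h : r ∈ Set.Ioi p
          · rw [Set.indicator_of_mem h, Set.indicator_of_mem h, Pi.one_apply, one_mul]
          · rw [Set.indicator_of_notMem h, Set.indicator_of_notMem h, zero_mul]
      _ = ENNReal.ofReal (Real.exp (-(3 / 8 * (p / M))))
            * ∫⁻ x, B x * F x ∂Measure.pi (fun _ : ι => halfLine) := by
          rw [integrateOut_const_mul ENNReal.ofReal_ne_top,
            lintegral_mul_eq_integrateOut hF.measurable hBm _ hBd]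
      _ ≤ _ := by
          rw [Finset.card_insert_of_notMem he, pow_succ', mul_assoc]
          exact mul_le_mul' le_rfl (ih hST.2)

end Marginals

/-! ### From the real density to its extension. -/

section Density

variable {ι : Type*} [Fintype ι] {f : (ι → ℝ) → ℝ}

/-- The density `f` on `[0,∞)^ι`, extended to all of `ι → ℝ` through positive parts. -/
noncomputable def extendDensity {ι : Type*} (f : (ι → ℝ) → ℝ) (x : ι → ℝ) : ℝ≥0∞ :=
  ENNReal.ofReal (f (x ⊔ 0))

/-- The positive part of `s • x + t • y` is at most `s • x⁺ + t • y⁺`, so down-monotonicity carries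
log-concavity over to the extension. -/
theorem IsLogConcaveDownMonotone.isLogConcaveAntitone {ι : Type*}
    {f : (ι → ℝ) → ℝ} (hf : IsLogConcaveDownMonotone f)
    (hm : Measurable f) : IsLogConcaveAntitone (extendDensity f) where
  measurable := ENNReal.measurable_ofReal.comp (hm.comp (measurable_pi_lambda _ fun i =>
    (measurable_pi_apply i).max measurable_const))
  antitone x y h := ENNReal.ofReal_le_ofReal
    (hf.downMonotone _ _ le_sup_right (sup_le_sup_right h 0))
  sup_zero x := by simp [extendDensity]
  logConcave x y s t hs ht hst := by
    unfold extendDensity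
    rw [ENNReal.ofReal_rpow_of_nonneg (hf.nonneg _) hs.le,
      ENNReal.ofReal_rpow_of_nonneg (hf.nonneg _) ht.le,
      ← ENNReal.ofReal_mul (Real.rpow_nonneg (hf.nonneg _) _)]
    refine ENNReal.ofReal_le_ofReal ((hf.logConcave _ _ le_sup_right le_sup_right s t hs ht
      hst).trans (hf.downMonotone _ _ le_sup_right ?_))
    refine sup_le (fun i => ?_) (fun i => ?_)
    · have h1 : x i ≤ (x ⊔ 0) i := le_sup_left (a := x i) (b := 0)
      have h2 : y i ≤ (y ⊔ 0) i := le_sup_left (a := y i) (b := 0)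
      simp only [Pi.add_apply, Pi.smul_apply, smul_eq_mul]
      gcongr
    · have h1 : 0 ≤ (x ⊔ 0) i := le_sup_right (a := x i) (b := 0)
      have h2 : 0 ≤ (y ⊔ 0) i := le_sup_right (a := y i) (b := 0)
      simp only [Pi.add_apply, Pi.smul_apply, smul_eq_mul, Pi.zero_apply]
      positivity

theorem pi_halfLine_eq_restrict :
    Measure.pi (fun _ : ι => halfLine) = volume.restrict (Set.Ici (0 : ι → ℝ)) := by
  unfold halfLine
  rw [← Measure.restrict_pi_pi, volume_pi, Set.pi_univ_Ici]
  rfl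

theorem lintegral_pi_halfLine {g h : (ι → ℝ) → ℝ≥0∞} (hgh : ∀ x, 0 ≤ x → g x = h x)
    (hh : ∀ x, ¬ 0 ≤ x → h x = 0) :
    ∫⁻ x, g x ∂Measure.pi (fun _ : ι => halfLine) = ∫⁻ x, h x := by
  rw [pi_halfLine_eq_restrict, ← lintegral_indicator measurableSet_Ici]
  refine lintegral_congr fun x => ?_
  by_cases hx : x ∈ Set.Ici (0 : ι → ℝ)
  · rw [Set.indicator_of_mem hx, hgh x hx]
  · rw [Set.indicator_of_notMem hx, hh x hx]

theorem IsLogConcaveDownMonotone.lintegral_mul_extendDensity (hf : IsLogConcaveDownMonotone f)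
    (g : (ι → ℝ) → ℝ≥0∞) :
    ∫⁻ x, g x * extendDensity f x ∂Measure.pi (fun _ : ι => halfLine)
      = ∫⁻ x, g x * ENNReal.ofReal (f x) :=
  lintegral_pi_halfLine (fun x hx => by rw [extendDensity, sup_eq_left.2 hx])
    fun x hx => by rw [hf.support x hx]; simp

theorem IsLogConcaveDownMonotone.lintegral_comp {Ω : Type*} [MeasurableSpace Ω]
    {P : Measure Ω} {X : Ω → ι → ℝ} (hf : IsLogConcaveDownMonotone f)
    (hm : Measurable f) (hX : Measurable X)
    (hP : P.map X = volume.withDensity fun x => ENNReal.ofReal (f x))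
    {g : (ι → ℝ) → ℝ≥0∞} (hg : Measurable g) :
    ∫⁻ ω, g (X ω) ∂P
      = ∫⁻ x, g x * extendDensity f x ∂Measure.pi (fun _ : ι => halfLine) := by
  rw [hf.lintegral_mul_extendDensity, ← lintegral_map hg hX, hP,
    lintegral_withDensity_eq_lintegral_mul _ (f := fun x => ENNReal.ofReal (f x))
      (ENNReal.measurable_ofReal.comp hm) hg]
  refine lintegral_congr fun x => ?_
  rw [Pi.mul_apply, mul_comm]

variable [DecidableEq ι]

theorem integrateOut_compl_eq_glue (G : (ι → ℝ) → ℝ≥0∞) (U : Finset ι) (x : ι → ℝ) :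
    integrateOut Uᶜ G x = ∫⁻ z : {i // i ∉ U} → ℝ, G (glue U (fun i => x i) z)
      ∂Measure.pi (fun _ => halfLine) := by
  let e : {i // i ∈ Uᶜ} ≃ {i // i ∉ U} := Equiv.subtypeEquivRight fun i => Finset.mem_compl
  have h := (measurePreserving_piCongrLeft (fun _ : {i // i ∉ U} => halfLine) e).lintegral_map_equiv
    (fun z => G (glue U (fun i => x i) z))
  rw [h]
  refine lintegral_congr fun y => congrArg G ?_
  ext i
  by_cases hi : i ∈ U
  · simp [glue, Function.updateFinset, hi]
  · have h1 : i ∈ Uᶜ := Finset.mem_compl.2 hi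
    simp only [glue, Function.updateFinset, hi, h1, dif_pos, dif_neg, not_false_eq_true]
    exact (Equiv.piCongrLeft_apply_apply (fun _ => ℝ) e y ⟨i, h1⟩).symm

theorem IsLogConcaveDownMonotone.integrateOut_compl_eq (hf : IsLogConcaveDownMonotone f)
    (U : Finset ι) (k : ({i // i ∉ U} → ℝ) → ℝ) (hk : ∀ z, 0 ≤ k z) (x : ι → ℝ) :
    integrateOut Uᶜ (fun y => ENNReal.ofReal (k fun i => y i) * extendDensity f y) x
      = ∫⁻ z : {i // i ∉ U} → ℝ,
          ENNReal.ofReal (k z * f (glue U (fun i => x i ⊔ 0) z)) := by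
  rw [integrateOut_compl_eq_glue]
  have hz : ∀ (y : {i // i ∈ U} → ℝ) z, (fun i : {i // i ∉ U} => glue U y z i) = z := by
    intro y z
    ext i
    simp [glue, i.2]
  refine lintegral_pi_halfLine (fun z hz0 => ?_) fun z hz0 => ?_
  · rw [hz, ENNReal.ofReal_mul (hk z), extendDensity]
    congr 3
    ext i
    by_cases hi : i ∈ U
    · simp [glue, hi]
    · simpa [glue, hi] using hz0 ⟨i, hi⟩
  · rw [hf.support, mul_zero, ENNReal.ofReal_zero]
    intro h
    refine hz0 fun i => ?_
    have := h i
    simpa [glue, i.2] using this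

theorem IsLogConcaveDownMonotone.secondMoment_le (hf : IsLogConcaveDownMonotone f)
    (hm : Measurable f) {U : Finset ι} (hU : U.Nonempty) {e : ι} (he : e ∉ U) (x : ι → ℝ)
    (htop : integrateOut Uᶜ (extendDensity f) x ≠ ∞) :
    ∫⁻ r, ENNReal.ofReal (r ^ 2)
        * integrateOut (insert e U)ᶜ (extendDensity f) (Function.update x e r) ∂halfLine
      ≤ maxCondSecondMoment f * integrateOut Uᶜ (extendDensity f) x := by
  have hF := hf.isLogConcaveAntitone hm
  have hmarg : marginalDensity f U (fun i => x i ⊔ 0) = integrateOut Uᶜ (extendDensity f) x := by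
    have := hf.integrateOut_compl_eq U (fun _ => 1) (fun _ => zero_le_one) x
    simp only [ENNReal.ofReal_one, one_mul] at this
    exact this.symm
  -- Points of zero marginal density are not covered by the supremum, but there almost every slice
  -- vanishes and both sides are zero.
  rcases eq_or_ne (integrateOut Uᶜ (extendDensity f) x) 0 with h0 | h0
  · rw [integrateOut_compl_eq_lintegral he hF.measurable, lintegral_eq_zero_iff
      ((hF.integrateOut _).slice_antitone x e).measurable] at h0
    have : ∀ᵐ r ∂halfLine, ENNReal.ofReal (r ^ 2)
        * integrateOut (insert e U)ᶜ (extendDensity f) (Function.update x e r) = 0 := by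
      filter_upwards [h0] with r hr
      rw [hr]; simp
    rw [lintegral_congr_ae this]
    simp
  · have h1 : condSecondMoment f U (fun i => x i ⊔ 0) ⟨e, he⟩ ≤ maxCondSecondMoment f := by
      unfold maxCondSecondMoment
      refine le_iSup_of_le U (le_iSup_of_le hU (le_iSup_of_le (fun i => x i ⊔ 0)
        (le_iSup_of_le (fun i => le_sup_right) (le_iSup_of_le (by rwa [hmarg])
        (le_iSup_of_le ⟨e, he⟩ le_rfl)))))
    rw [condSecondMoment, hmarg, ENNReal.div_le_iff h0 htop] at h1
    refine le_trans (le_of_eq ?_) h1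
    rw [← integrateOut_compl_mul_eq_lintegral (k := fun r => ENNReal.ofReal (r ^ 2)) he
      hF.measurable (by fun_prop)]
    exact hf.integrateOut_compl_eq U (fun z => z ⟨e, he⟩ ^ 2) (fun z => sq_nonneg _) x

variable {Ω : Type*} [MeasurableSpace Ω] {P : Measure Ω} [IsProbabilityMeasure P]
  {X : Ω → ι → ℝ}

/-- The unconditional second moment is the average of those conditioned on one other coordinate,
which is why the index type must be nontrivial. It yields finiteness of the moments and `σ ≤ M`. -/
theorem IsLogConcaveDownMonotone.lintegral_sq_le (hf : IsLogConcaveDownMonotone f)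
    (hm : Measurable f) (hX : Measurable X)
    (hP : P.map X = volume.withDensity fun x => ENNReal.ofReal (f x)) [Nontrivial ι] (e : ι) :
    ∫⁻ ω, ENNReal.ofReal (X ω e ^ 2) ∂P ≤ maxCondSecondMoment f := by
  have hF := hf.isLogConcaveAntitone hm
  have hmass : ∫⁻ x, extendDensity f x ∂Measure.pi (fun _ : ι => halfLine) = 1 := by
    have := hf.lintegral_comp hm hX hP (g := fun _ => 1) measurable_const
    simpa using this.symm
  obtain ⟨e', he⟩ := exists_ne e
  have hsl : ∫⁻ r, integrateOut {e'}ᶜ (extendDensity f) (Function.update 0 e' r) ∂halfLine = 1 := by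
    have := lintegral_coord_mul e' hF.measurable (k := fun _ => 1) measurable_const
    simp only [one_mul] at this
    rw [← this, hmass]
  have hφ := hF.integrateOut {e'}ᶜ
  have hfin := zero_ne_top_of_lintegral_eq_one (hφ.slice_antitone 0 e')
    (fun s t hs ht hst a b => hφ.slice_logConcave 0 e' hs ht hst a b) hsl
  rw [show Function.update (0 : ι → ℝ) e' (0 : ℝ) = 0 from Function.update_eq_self e' _] at hfin
  rw [hf.lintegral_comp hm hX hP (g := fun x => ENNReal.ofReal (x e ^ 2)) (by fun_prop),
    ← integrateOut_univ_eq 0, ← Finset.compl_empty,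
    integrateOut_compl_eq_lintegral (F := fun x => ENNReal.ofReal (x e ^ 2) * extendDensity f x)
      (Finset.notMem_empty e') ((by fun_prop : Measurable fun x : ι → ℝ =>
        ENNReal.ofReal (x e ^ 2)).mul hF.measurable)]
  have he2 : e ∉ ({e'} : Finset ι) := by simpa using he.symm
  calc ∫⁻ r, integrateOut {e'}ᶜ (fun x => ENNReal.ofReal (x e ^ 2) * extendDensity f x)
          (Function.update 0 e' r) ∂halfLine
      ≤ ∫⁻ r, maxCondSecondMoment f
          * integrateOut {e'}ᶜ (extendDensity f) (Function.update 0 e' r) ∂halfLine := by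
        refine lintegral_mono fun r => ?_
        rw [integrateOut_compl_mul_eq_lintegral (k := fun r => ENNReal.ofReal (r ^ 2)) he2
          hF.measurable (by fun_prop)]
        exact hf.secondMoment_le hm (Finset.singleton_nonempty e') he2 _
          (ne_top_of_le_ne_top hfin (hφ.le_zero _))
    _ = maxCondSecondMoment f := by
        rw [lintegral_const_mul _ (hφ.slice_antitone 0 e').measurable, hsl, mul_one]

theorem lintegral_sq_pos {ι Ω : Type*} [Fintype ι] [MeasurableSpace Ω] {P : Measure Ω}
    [IsProbabilityMeasure P] {X : Ω → ι → ℝ} (hX : Measurable X) {ρ : (ι → ℝ) → ℝ≥0∞}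
    (hP : P.map X = volume.withDensity ρ) (e : ι) :
    0 < ∫⁻ ω, ENNReal.ofReal (X ω e ^ 2) ∂P := by
  rw [pos_iff_ne_zero]
  intro h
  rw [lintegral_eq_zero_iff (by fun_prop)] at h
  have h1 : ∀ᵐ x ∂P.map X, x e ≠ 0 := by
    rw [hP]
    refine (withDensity_absolutelyContinuous _ _).ae_le ?_
    rw [volume_pi]
    have := (Measure.quasiMeasurePreserving_eval (μ := fun _ : ι => (volume : Measure ℝ)) e)
    exact this.ae (Measure.ae_ne volume 0)
  have h2 := ae_of_ae_map hX.aemeasurable h1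
  have h3 : ∀ᵐ ω ∂P, False := by
    filter_upwards [h, h2] with ω hω hω'
    have : X ω e ^ 2 ≤ 0 := by simpa using hω
    exact hω' (by nlinarith)
  exact (IsProbabilityMeasure.ne_zero P) (by simpa using h3)

end Density

/-! ### Tail bounds for the random vector. -/

section Bounds

theorem prod_indicator_one {ι : Type*} (S : Finset ι) (B : Set ℝ) (x : ι → ℝ) :
    ∏ i ∈ S, B.indicator (1 : ℝ → ℝ≥0∞) (x i) = {y : ι → ℝ | ∀ i ∈ S, y i ∈ B}.indicator 1 x := by
  classical
  by_cases h : ∀ i ∈ S, x i ∈ B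
  · rw [Set.indicator_of_mem (by exact h)]
    exact Finset.prod_eq_one fun i hi => by rw [Set.indicator_of_mem (h i hi)]; rfl
  · rw [Set.indicator_of_notMem (by exact h)]
    push Not at h
    obtain ⟨i, hi, hB⟩ := h
    exact Finset.prod_eq_zero hi (Set.indicator_of_notMem hB _)

/-- Tail bounds for the coordinates of a random vector: any set `S` of coordinates is at most `p`
and any disjoint set `T` exceeds `p` with the probability that suitable independent exponential
variables of scales `σ` and `M` would allow, up to constants. -/
structure HasTailBounds {ι Ω : Type*} [MeasurableSpace Ω] (P : Measure Ω) (X : Ω → ι → ℝ)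
    (σ M : ℝ) : Prop where
  sigma_pos : 0 < σ
  sigma_le : σ ≤ M
  joint : ∀ p > 0, ∀ S T : Finset ι, S.Nonempty → Disjoint S T →
    P.real {ω | (∀ i ∈ S, X ω i ≤ p) ∧ ∀ i ∈ T, p < X ω i}
      ≤ (12 * Real.exp 1 * p / σ) ^ S.card * Real.exp (-(3 / 8 * (p / M))) ^ T.card
  tail : ∀ p > 0, ∀ T : Finset ι, T.Nonempty →
    P.real {ω | ∀ i ∈ T, p < X ω i} ≤ Real.exp (-(3 / 8 * (p / M))) ^ (T.card - 1)

variable {ι : Type*} [Fintype ι] [DecidableEq ι] {f : (ι → ℝ) → ℝ}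
  {Ω : Type*} [MeasurableSpace Ω] {P : Measure Ω} [IsProbabilityMeasure P] {X : Ω → ι → ℝ}

theorem IsLogConcaveDownMonotone.hasTailBounds (hf : IsLogConcaveDownMonotone f)
    (hm : Measurable f) (hX : Measurable X)
    (hP : P.map X = volume.withDensity fun x => ENNReal.ofReal (f x)) [Nontrivial ι]
    (hfin : maxCondSecondMoment f ≠ ∞) :
    HasTailBounds P X √(⨅ e : ι, ∫ ω, X ω e ^ 2 ∂P) (maxCondRMS f) := by
  have hF := hf.isLogConcaveAntitone hm
  have hmass : ∫⁻ x, extendDensity f x ∂Measure.pi (fun _ : ι => halfLine) = 1 := by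
    have := hf.lintegral_comp hm hX hP (g := fun _ => 1) measurable_const
    simpa using this.symm
  have hle := hf.lintegral_sq_le hm hX hP
  have hpos := lintegral_sq_pos hX hP
  have hint : ∀ e, ∫ ω, X ω e ^ 2 ∂P = (∫⁻ ω, ENNReal.ofReal (X ω e ^ 2) ∂P).toReal := fun e =>
    integral_eq_lintegral_of_nonneg_ae (Filter.Eventually.of_forall fun ω => sq_nonneg _)
      (by fun_prop : Measurable fun ω => X ω e ^ 2).aestronglyMeasurable
  have hne : ∀ e, ∫⁻ ω, ENNReal.ofReal (X ω e ^ 2) ∂P ≠ ∞ := fun e =>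
    ne_top_of_le_ne_top hfin (hle e)
  have hm2 : ∀ e, 0 < ∫ ω, X ω e ^ 2 ∂P := fun e => by
    rw [hint]; exact ENNReal.toReal_pos (hpos e).ne' (hne e)
  have hbdd : BddBelow (Set.range fun e : ι => ∫ ω, X ω e ^ 2 ∂P) := (Set.finite_range _).bddBelow
  have hinf : 0 < ⨅ e : ι, ∫ ω, X ω e ^ 2 ∂P := by
    obtain ⟨e, he⟩ := exists_eq_ciInf_of_finite (f := fun e : ι => ∫ ω, X ω e ^ 2 ∂P)
    rw [← he]; exact hm2 e
  have hσ : 0 < √(⨅ e : ι, ∫ ω, X ω e ^ 2 ∂P) := Real.sqrt_pos.2 hinf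
  have hσM : √(⨅ e : ι, ∫ ω, X ω e ^ 2 ∂P) ≤ maxCondRMS f := by
    refine Real.sqrt_le_sqrt ?_
    obtain ⟨e⟩ : Nonempty ι := inferInstance
    refine (ciInf_le hbdd e).trans ?_
    rw [hint]
    exact ENNReal.toReal_mono hfin (hle e)
  have hM : 0 < maxCondRMS f := hσ.trans_le hσM
  have hM2 : ENNReal.ofReal (maxCondRMS f ^ 2) = maxCondSecondMoment f := by
    rw [maxCondRMS, Real.sq_sqrt ENNReal.toReal_nonneg, ENNReal.ofReal_toReal hfin]
  have hsec : ∀ e, ENNReal.ofReal (√(⨅ e : ι, ∫ ω, X ω e ^ 2 ∂P) ^ 2)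
      ≤ ∫⁻ x, ENNReal.ofReal (x e ^ 2) * extendDensity f x
        ∂Measure.pi (fun _ : ι => halfLine) := fun e => by
    rw [← hf.lintegral_comp hm hX hP (g := fun x => ENNReal.ofReal (x e ^ 2)) (by fun_prop),
      Real.sq_sqrt hinf.le, ENNReal.ofReal_le_iff_le_toReal (hne e), ← hint]
    exact ciInf_le hbdd e
  have hcond : ∀ U : Finset ι, U.Nonempty → ∀ e ∉ U, ∀ x : ι → ℝ,
      ∫⁻ r, ENNReal.ofReal (r ^ 2)
          * integrateOut (insert e U)ᶜ (extendDensity f) (Function.update x e r) ∂halfLine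
        ≤ ENNReal.ofReal (maxCondRMS f ^ 2) * integrateOut Uᶜ (extendDensity f) x := by
    intro U hU e he x
    rcases eq_or_ne (integrateOut Uᶜ (extendDensity f) x) ∞ with h | h
    · rw [h, ENNReal.mul_top (by simpa using hM.ne')]; exact le_top
    · rw [hM2]; exact hf.secondMoment_le hm hU he x h
  set σ := √(⨅ e : ι, ∫ ω, X ω e ^ 2 ∂P)
  have hmS : ∀ (B : Set ℝ) (_ : MeasurableSet B) (S : Finset ι),
      Measurable fun y : ι → ℝ => ∏ i ∈ S, B.indicator (1 : ℝ → ℝ≥0∞) (y i) := fun B hB S =>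
    Finset.measurable_fun_prod _ fun i _ =>
      (measurable_one.indicator hB).comp (measurable_pi_apply i)
  have hdep : ∀ (B : Set ℝ) (S : Finset ι) (x y : ι → ℝ), (∀ i ∈ S, x i = y i) →
      ∏ i ∈ S, B.indicator (1 : ℝ → ℝ≥0∞) (x i) = ∏ i ∈ S, B.indicator (1 : ℝ → ℝ≥0∞) (y i) :=
    fun B S x y h => Finset.prod_congr rfl fun i hi => by rw [h i hi]
  have hmeas : ∀ (B : Set ℝ) (_ : MeasurableSet B) (S : Finset ι),
      MeasurableSet {y : ι → ℝ | ∀ i ∈ S, y i ∈ B} := fun B hB S => by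
    rw [show {y : ι → ℝ | ∀ i ∈ S, y i ∈ B} = ⋂ i ∈ S, (fun y : ι → ℝ => y i) ⁻¹' B by
      ext y; simp]
    exact Finset.measurableSet_biInter _ fun i _ => measurable_pi_apply i hB
  have hprob : ∀ E : Set (ι → ℝ), MeasurableSet E → P {ω | X ω ∈ E}
      = ∫⁻ x, E.indicator 1 x * extendDensity f x ∂Measure.pi (fun _ : ι => halfLine) := by
    intro E hE
    rw [← hf.lintegral_comp hm hX hP (measurable_one.indicator hE)]
    exact (lintegral_indicator_one (hX hE)).symm
  have real_le : ∀ (E : Set Ω) (c : ℝ), 0 ≤ c → P E ≤ ENNReal.ofReal c → P.real E ≤ c :=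
    fun E c hc h => ENNReal.toReal_le_of_le_ofReal hc h
  have hq : ∀ p, 0 ≤ Real.exp (-(3 / 8 * (p / maxCondRMS f))) := fun p => (Real.exp_pos _).le
  refine ⟨hσ, hσM, fun p hp S T hS hST => ?_, fun p hp T hT => ?_⟩
  · refine real_le _ _ (by positivity) ?_
    rw [ENNReal.ofReal_mul (by positivity), ENNReal.ofReal_pow (by positivity),
      ENNReal.ofReal_pow (hq p)]
    have h1 := hprob ({y | ∀ i ∈ S, y i ∈ Set.Iic p} ∩ {y | ∀ i ∈ T, y i ∈ Set.Ioi p})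
      ((hmeas _ measurableSet_Iic S).inter (hmeas _ measurableSet_Ioi T))
    refine h1.trans_le ?_
    simp_rw [Set.inter_indicator_one, Pi.mul_apply, ← prod_indicator_one]
    refine (hF.lintegral_tail_le hM hp hcond hS (hmS _ measurableSet_Iic S)
      (hdep _ S) hST).trans ?_
    rw [mul_comm]
    exact mul_le_mul' (hF.lintegral_box_le hmass hS hσ hp fun i _ => hsec i) le_rfl
  · refine real_le _ _ (by positivity) ?_
    rw [ENNReal.ofReal_pow (hq p)]
    obtain ⟨e, he⟩ := hT
    have h1 := hprob {y | ∀ i ∈ T, y i ∈ Set.Ioi p} (hmeas _ measurableSet_Ioi T)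
    refine h1.trans_le ?_
    simp_rw [← prod_indicator_one, ← Finset.mul_prod_erase T _ he]
    -- One coordinate of `T` serves as the nonempty conditioning set and contributes no factor,
    -- hence the exponent `T.card - 1`.
    have h2 := hF.lintegral_tail_le hM hp hcond (Finset.singleton_nonempty e)
      (hmS (Set.Ioi p) measurableSet_Ioi {e}) (hdep (Set.Ioi p) {e}) (T := T.erase e)
      (Finset.disjoint_singleton_left.2 (Finset.notMem_erase e T))
    simp_rw [Finset.prod_singleton] at h2
    refine h2.trans ?_
    rw [Finset.card_erase_of_mem he]
    refine mul_le_of_le_one_right' ?_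
    rw [← hmass]
    refine lintegral_mono fun x => mul_le_of_le_one_left' ?_
    exact Set.indicator_le' (fun _ _ => le_rfl) (fun _ _ => zero_le_one) _

end Bounds

/-! ### Spanning trees and balanced unions of components. -/

section Trees

/-- A connected component with at least `k ≥ 1` vertices contains a rooted tree on `k` vertices,
given here by the map sending each vertex to its parent and the root to itself. -/
theorem SimpleGraph.ConnectedComponent.exists_parent_map {V : Type*} [Finite V] [DecidableEq V]
    {G : SimpleGraph V} (C : G.ConnectedComponent) {k : ℕ} (hk : 1 ≤ k) (hkC : k ≤ C.supp.ncard) :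
    ∃ (K : Finset V) (π : V → V) (r : V), (K : Set V) ⊆ C.supp ∧ K.card = k ∧ r ∈ K ∧ π r = r ∧
      (∀ v ∈ K, π v ∈ K) ∧ (∀ v ∉ K, π v = v) ∧ (∀ v ∈ K, v ≠ r → G.Adj v (π v)) ∧
      Set.InjOn (fun v => s(v, π v)) (K.erase r : Finset V) := by
  induction k, hk using Nat.le_induction with
  | base =>
    obtain ⟨r, hr⟩ := C.nonempty_supp
    exact ⟨{r}, id, r, by simpa using hr, by simp, by simp, rfl, by simp, by simp, by simp,
      by simp⟩
  | succ k hk ih =>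
    obtain ⟨K, π, r, hKC, hcard, hr, hπr, hK, hK', hadj, hinj⟩ := ih (by omega)
    obtain ⟨z, hzC, hzK⟩ : ∃ z ∈ C.supp, z ∉ (K : Set V) := by
      by_contra! h
      have := Set.ncard_le_ncard (s := C.supp) (t := K) h K.finite_toSet
      rw [Set.ncard_coe_finset] at this
      omega
    have hrC := hKC hr
    obtain ⟨W⟩ : G.Reachable r z := by
      rw [SimpleGraph.ConnectedComponent.mem_supp_iff] at hrC hzC
      exact SimpleGraph.ConnectedComponent.exact (hrC.trans hzC.symm)
    -- A walk from the root to a vertex outside `K` must leave `K`; the crossing edge attaches a new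
    -- leaf.
    obtain ⟨d, -, hd1, hd2⟩ := W.exists_boundary_dart (K : Set V) hr hzK
    have hd1 : d.fst ∈ K := hd1
    have hd2 : d.snd ∉ K := hd2
    have hne : ∀ v ∈ K, v ≠ d.snd := fun v hv h => hd2 (h ▸ hv)
    have hup : ∀ v ∈ K, Function.update π d.snd d.fst v = π v := fun v hv =>
      Function.update_of_ne (hne v hv) _ _
    refine ⟨insert d.snd K, Function.update π d.snd d.fst, r, ?_, ?_,
      Finset.mem_insert_of_mem hr, ?_, ?_, ?_, ?_, ?_⟩
    · rw [Finset.coe_insert, Set.insert_subset_iff]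
      refine ⟨?_, hKC⟩
      exact C.mem_supp_of_adj_mem_supp (hKC hd1) d.adj
    · rw [Finset.card_insert_of_notMem hd2, hcard]
    · rw [hup r hr, hπr]
    · intro v hv
      rcases Finset.mem_insert.1 hv with rfl | hv
      · rw [Function.update_self]; exact Finset.mem_insert_of_mem hd1
      · rw [hup v hv]; exact Finset.mem_insert_of_mem (hK v hv)
    · intro v hv
      rw [Finset.mem_insert, not_or] at hv
      rw [Function.update_of_ne hv.1, hK' v hv.2]
    · intro v hv hvr
      rcases Finset.mem_insert.1 hv with rfl | hv
      · rw [Function.update_self]; exact d.adj.symm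
      · rw [hup v hv]; exact hadj v hv hvr
    · have hnew : ∀ v ∈ K, s(d.snd, d.fst) ≠ s(v, π v) := by
        intro v hv h
        have : d.snd ∈ s(v, π v) := h ▸ Sym2.mem_mk_left _ _
        rcases Sym2.mem_iff.1 this with h | h
        · exact hne v hv h.symm
        · exact hne _ (hK v hv) h.symm
      intro a ha b hb hab
      simp only [Finset.coe_erase, Finset.coe_insert, Set.mem_sdiff, Set.mem_insert_iff,
        Finset.mem_coe, Set.mem_singleton_iff] at ha hb
      simp only at hab
      rcases ha with ⟨rfl | ha, har⟩ <;> rcases hb with ⟨rfl | hb, hbr⟩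
      · rfl
      · rw [Function.update_self, hup b hb] at hab
        exact absurd hab (hnew b hb)
      · rw [Function.update_self, hup a ha] at hab
        exact absurd hab.symm (hnew a ha)
      · rw [hup a ha, hup b hb] at hab
        exact hinj (by simp [ha, har]) (by simp [hb, hbr]) hab

/-- If no connected component has more than half of the vertices, some union of components has
between one and two thirds of them. -/
theorem SimpleGraph.exists_closed_finset {V : Type*} [Fintype V] [DecidableEq V]
    (G : SimpleGraph V) (h : ∀ C : G.ConnectedComponent, 2 * C.supp.ncard ≤ Fintype.card V) :
    ∃ K : Finset V, Fintype.card V ≤ 3 * K.card ∧ 3 * K.card ≤ 2 * Fintype.card V ∧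
      ∀ u v, G.Adj u v → (u ∈ K ↔ v ∈ K) := by
  classical
  -- Take a largest closed set of at most `2/3` of the vertices. If it has fewer than `1/3`, adding
  -- a further component overshoots `2/3`, so that component alone has more than `1/3` and, by
  -- hypothesis, at most `1/2`.
  obtain ⟨K, hK, hmax⟩ := Finset.exists_max_image
    (Finset.univ.filter fun K : Finset V => 3 * K.card ≤ 2 * Fintype.card V ∧
      ∀ u v, G.Adj u v → (u ∈ K ↔ v ∈ K)) Finset.card ⟨∅, by simp⟩
  simp only [Finset.mem_filter, Finset.mem_univ, true_and] at hK hmax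
  rcases le_or_gt (Fintype.card V) (3 * K.card) with h1 | h1
  · exact ⟨K, h1, hK⟩
  obtain ⟨v, hv⟩ : ∃ v, v ∉ K := by
    by_contra! hall
    have : K = Finset.univ := Finset.eq_univ_iff_forall.2 hall
    rw [this, Finset.card_univ] at h1
    omega
  set C := G.connectedComponentMk v with hC
  set D : Finset V := C.supp.toFinset with hD
  have hDcard : D.card = C.supp.ncard := (Set.ncard_eq_toFinset_card' _).symm
  have hclosed : ∀ u w, G.Adj u w → (u ∈ D ↔ w ∈ D) := fun u w huw => by
    rw [hD, Set.mem_toFinset, Set.mem_toFinset]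
    exact ⟨fun hu => C.mem_supp_of_adj_mem_supp hu huw,
      fun hw => C.mem_supp_of_adj_mem_supp hw huw.symm⟩
  have hvD : v ∈ D := by rw [hD, Set.mem_toFinset]; rfl
  have hC2 := h C
  have hbig : 2 * Fintype.card V < 3 * (K ∪ D).card := by
    by_contra! hle
    have := hmax (K ∪ D) ⟨hle, fun u w huw => by
      rw [Finset.mem_union, Finset.mem_union, hK.2 u w huw, hclosed u w huw]⟩
    have hlt : K.card < (K ∪ D).card := Finset.card_lt_card
      ⟨Finset.subset_union_left, fun hsub => hv (hsub (Finset.mem_union_right _ hvD))⟩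
    omega
  have := Finset.card_union_le K D
  exact ⟨D, by omega, by omega, hclosed⟩

end Trees

/-! ### Counting trees and cuts. -/

section EdgeSets

variable {n : ℕ}

theorem EdgeIdx.mk_injective :
    Function.Injective fun e : EdgeIdx n => s(e.1.1, e.1.2) := by
  rintro ⟨⟨a, b⟩, h⟩ ⟨⟨c, d⟩, h'⟩ heq
  simp only [Sym2.eq_iff] at heq
  simp only at h h'
  rcases heq with ⟨rfl, rfl⟩ | ⟨rfl, rfl⟩
  · rfl
  · exact absurd h (lt_asymm h')

theorem EdgeIdx.exists_mk {u v : Fin n} (h : u ≠ v) :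
    ∃ e : EdgeIdx n, s(e.1.1, e.1.2) = s(u, v) := by
  rcases lt_or_gt_of_ne h with h | h
  · exact ⟨⟨(u, v), h⟩, rfl⟩
  · exact ⟨⟨(v, u), h⟩, Sym2.eq_swap⟩

theorem thresholdGraph_adj_iff {x : EdgeIdx n → ℝ} {p : ℝ} {e : EdgeIdx n} {u v : Fin n}
    (he : s(e.1.1, e.1.2) = s(u, v)) : (thresholdGraph x p).Adj u v ↔ x e ≤ p := by
  obtain ⟨⟨a, b⟩, h⟩ := e
  have key : (thresholdGraph x p).Adj a b ↔ x ⟨(a, b), h⟩ ≤ p := by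
    constructor
    · rintro (⟨_, h1⟩ | ⟨h2, _⟩)
      · exact h1
      · exact absurd h (lt_asymm h2)
    · exact fun h1 => Or.inl ⟨h, h1⟩
  rcases Sym2.eq_iff.1 he with ⟨rfl, rfl⟩ | ⟨rfl, rfl⟩
  · exact key
  · rw [SimpleGraph.adj_comm]; exact key

/-- The edges joining the vertices of `K` to their images under `π`. -/
def treeEdges (K : Finset (Fin n)) (π : Fin n → Fin n) : Finset (EdgeIdx n) :=
  Finset.univ.filter fun e => ∃ v ∈ K, π v ≠ v ∧ s(e.1.1, e.1.2) = s(v, π v)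

/-- The edges with exactly one end in `K`. -/
def cutEdges (K : Finset (Fin n)) : Finset (EdgeIdx n) :=
  Finset.univ.filter fun e => ¬ (e.1.1 ∈ K ↔ e.1.2 ∈ K)

theorem card_treeEdges {K : Finset (Fin n)} {π : Fin n → Fin n} {r : Fin n} (hr : r ∈ K)
    (hπr : π r = r) (hπ : ∀ v ∈ K, v ≠ r → π v ≠ v)
    (hinj : Set.InjOn (fun v => s(v, π v)) (K.erase r : Finset (Fin n))) :
    (treeEdges K π).card = K.card - 1 := by
  rw [← Finset.card_image_of_injective _ EdgeIdx.mk_injective, ← Finset.card_erase_of_mem hr,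
    ← Finset.card_image_of_injOn hinj]
  congr 1
  ext z
  simp only [Finset.mem_image, treeEdges, Finset.mem_filter, Finset.mem_univ, true_and,
    Finset.mem_erase]
  constructor
  · rintro ⟨e, ⟨v, hv, hne, he⟩, rfl⟩
    exact ⟨v, ⟨fun h => hne (h ▸ hπr), hv⟩, he.symm⟩
  · rintro ⟨v, ⟨hvr, hv⟩, rfl⟩
    obtain ⟨e, he⟩ := EdgeIdx.exists_mk (hπ v hv hvr).symm
    exact ⟨e, ⟨v, hv, hπ v hv hvr, he⟩, he⟩

theorem card_cutEdges (K : Finset (Fin n)) : (cutEdges K).card = K.card * (n - K.card) := by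
  have : n - K.card = Kᶜ.card := by rw [Finset.card_compl, Fintype.card_fin]
  rw [this, ← Finset.card_product, ← Finset.card_image_of_injective _ EdgeIdx.mk_injective]
  have hinj : Set.InjOn (fun q : Fin n × Fin n => s(q.1, q.2)) (K ×ˢ Kᶜ : Finset _) := by
    rintro ⟨a, b⟩ h1 ⟨c, d⟩ h2 heq
    simp only [Finset.coe_product, Set.mem_prod, Finset.mem_coe, Finset.mem_compl] at h1 h2
    rcases Sym2.eq_iff.1 heq with ⟨rfl, rfl⟩ | ⟨rfl, rfl⟩
    · rfl
    · exact absurd h1.1 h2.2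
  rw [← Finset.card_image_of_injOn hinj]
  congr 1
  ext z
  simp only [Finset.mem_image, cutEdges, Finset.mem_filter, Finset.mem_univ, true_and,
    Finset.mem_product, Finset.mem_compl, Prod.exists]
  constructor
  · rintro ⟨e, he, rfl⟩
    by_cases h1 : e.1.1 ∈ K
    · exact ⟨e.1.1, e.1.2, ⟨h1, fun h2 => he (by simp [h1, h2])⟩, rfl⟩
    · exact ⟨e.1.2, e.1.1, ⟨by by_contra h2; exact he (by simp [h1, h2]), h1⟩, Sym2.eq_swap⟩
  · rintro ⟨a, b, ⟨ha, hb⟩, rfl⟩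
    obtain ⟨e, he⟩ := EdgeIdx.exists_mk (u := a) (v := b) (fun h => hb (h ▸ ha))
    refine ⟨e, ?_, he⟩
    rcases Sym2.eq_iff.1 he with ⟨h1, h2⟩ | ⟨h1, h2⟩ <;> simp [h1, h2, ha, hb]

theorem disjoint_treeEdges_cutEdges {K : Finset (Fin n)} {π : Fin n → Fin n}
    (hπ : ∀ v ∈ K, π v ∈ K) : Disjoint (treeEdges K π) (cutEdges K) := by
  rw [Finset.disjoint_left]
  intro e he hc
  simp only [treeEdges, cutEdges, Finset.mem_filter, Finset.mem_univ, true_and] at he hc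
  obtain ⟨v, hv, -, he⟩ := he
  rcases Sym2.eq_iff.1 he with ⟨h1, h2⟩ | ⟨h1, h2⟩ <;>
    exact hc (by simp [h1, h2, hv, hπ v hv])

theorem lt_of_mem_cutEdges {x : EdgeIdx n → ℝ} {p : ℝ} {K : Finset (Fin n)}
    (hK : ∀ u v, (thresholdGraph x p).Adj u v → (u ∈ K ↔ v ∈ K)) {e : EdgeIdx n}
    (he : e ∈ cutEdges K) : p < x e := by
  by_contra! h
  exact (Finset.mem_filter.1 he).2 (hK _ _ ((thresholdGraph_adj_iff rfl).2 h))

/-- The pairs `(K, π)` of a set of `k` vertices and the parent map of a rooted tree on it. -/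
def parentMaps (n k : ℕ) : Finset (Finset (Fin n) × (Fin n → Fin n)) :=
  (((Finset.univ : Finset (Fin n)).powersetCard k).sigma
    fun K => Fintype.piFinset fun v => if v ∈ K then K else {v}).image (fun q => (q.1, q.2))
    -- Only the number of edges is recorded: the union bound does not need acyclicity.
    |>.filter fun q => (treeEdges q.1 q.2).card = k - 1

theorem mem_parentMaps {k : ℕ} {K : Finset (Fin n)} {π : Fin n → Fin n} :
    (K, π) ∈ parentMaps n k ↔ (K.card = k ∧ (∀ v ∈ K, π v ∈ K) ∧ ∀ v ∉ K, π v = v) ∧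
      (treeEdges K π).card = k - 1 := by
  simp only [parentMaps, Finset.mem_filter, Finset.mem_image, Finset.mem_sigma,
    Finset.mem_powersetCard_univ, Fintype.mem_piFinset, Prod.mk.injEq]
  refine and_congr_left fun _ => ?_
  constructor
  · rintro ⟨⟨K', π'⟩, ⟨h1, h2⟩, rfl, rfl⟩
    refine ⟨h1, fun v hv => ?_, fun v hv => ?_⟩ <;> simpa [hv] using h2 v
  · rintro ⟨h1, h2, h3⟩
    refine ⟨⟨K, π⟩, ⟨h1, fun v => ?_⟩, rfl, rfl⟩
    by_cases hv : v ∈ K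
    · simpa [hv] using h2 v hv
    · simpa [hv] using h3 v hv

/-- Counting all `k ^ k` self-maps of each vertex set suffices, since `k ^ k / k! ≤ e ^ k`. -/
theorem card_parentMaps_le (n k : ℕ) :
    ((parentMaps n k).card : ℝ) ≤ (Real.exp 1 * n) ^ k := by
  have h1 : (parentMaps n k).card ≤ n.choose k * k ^ k := by
    refine (Finset.card_filter_le _ _).trans (Finset.card_image_le.trans ?_)
    rw [Finset.card_sigma, Finset.sum_congr rfl (g := fun _ => k ^ k), Finset.sum_const,
      Finset.card_powersetCard, Finset.card_univ, Fintype.card_fin, smul_eq_mul]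
    intro K hK
    rw [Finset.mem_powersetCard_univ] at hK
    rw [Fintype.card_piFinset]
    have : ∀ v, (if v ∈ K then K else {v} : Finset (Fin n)).card = if v ∈ K then k else 1 := by
      intro v; split_ifs <;> simp [hK]
    simp_rw [this]
    rw [Finset.prod_ite_mem, Finset.univ_inter, Finset.prod_const, hK]
  calc ((parentMaps n k).card : ℝ) ≤ (n.choose k : ℝ) * k ^ k := by exact_mod_cast h1
    _ ≤ (n : ℝ) ^ k / k.factorial * k ^ k := by gcongr; exact Nat.choose_le_pow_div k n
    _ = (k : ℝ) ^ k / k.factorial * (n : ℝ) ^ k := by ring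
    _ ≤ Real.exp k * (n : ℝ) ^ k := by
        gcongr
        exact Real.pow_div_factorial_le_exp (k : ℝ) (Nat.cast_nonneg k) k
    _ = _ := by rw [mul_pow, ← Real.exp_nat_mul, mul_one]

theorem SimpleGraph.ConnectedComponent.exists_mem_parentMaps {x : EdgeIdx n → ℝ} {p : ℝ}
    (C : (thresholdGraph x p).ConnectedComponent) {k : ℕ} (hk : 1 ≤ k)
    (hkC : k ≤ componentOrder C) :
    ∃ q ∈ parentMaps n k, (q.1 : Set (Fin n)) ⊆ C.supp ∧ ∀ e ∈ treeEdges q.1 q.2, x e ≤ p := by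
  obtain ⟨K, π, r, hKC, hcard, hr, hπr, hK, hK', hadj, hinj⟩ := C.exists_parent_map hk hkC
  have hne : ∀ v ∈ K, v ≠ r → π v ≠ v := fun v hv hvr => (hadj v hv hvr).ne'
  refine ⟨(K, π), mem_parentMaps.2 ⟨⟨hcard, hK, hK'⟩, ?_⟩, hKC, fun e he => ?_⟩
  · rw [card_treeEdges hr hπr hne hinj, hcard]
  · simp only [treeEdges, Finset.mem_filter, Finset.mem_univ, true_and] at he
    obtain ⟨v, hv, hvne, hev⟩ := he
    exact (thresholdGraph_adj_iff hev).1 (hadj v hv fun h => hvne (h ▸ hπr))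

end EdgeSets

/-! ### Union bounds for components. -/

section Components

variable {n : ℕ} {Ω : Type*} [MeasurableSpace Ω] {P : Measure Ω} [IsProbabilityMeasure P]
  {X : Ω → EdgeIdx n → ℝ} {σ M : ℝ}

theorem HasTailBounds.prob_component_ge (h : HasTailBounds P X σ M) {p : ℝ} (hp : 0 < p) {k : ℕ}
    (hk : 2 ≤ k) :
    P.real {ω | ∃ C : (thresholdGraph (X ω) p).ConnectedComponent, k ≤ componentOrder C}
      ≤ (Real.exp 1 * n) ^ k * (12 * Real.exp 1 * p / σ) ^ (k - 1) := by
  have hσ := h.sigma_pos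
  calc _ ≤ P.real (⋃ q ∈ parentMaps n k, {ω | ∀ e ∈ treeEdges q.1 q.2, X ω e ≤ p}) := by
        refine measureReal_mono ?_ (measure_ne_top _ _)
        rintro ω ⟨C, hC⟩
        obtain ⟨q, hq, -, hle⟩ := C.exists_mem_parentMaps (by omega) hC
        exact Set.mem_biUnion hq hle
    _ ≤ ∑ q ∈ parentMaps n k, P.real {ω | ∀ e ∈ treeEdges q.1 q.2, X ω e ≤ p} :=
        measureReal_biUnion_finset_le _ _
    _ ≤ ∑ _q ∈ parentMaps n k, (12 * Real.exp 1 * p / σ) ^ (k - 1) := by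
        refine Finset.sum_le_sum fun q hq => ?_
        have hcard := (mem_parentMaps.1 hq).2
        have := h.joint p hp (treeEdges q.1 q.2) ∅ (Finset.card_pos.1 (by omega))
          (Finset.disjoint_empty_right _)
        rw [hcard] at this
        simpa using this
    _ ≤ _ := by
        rw [Finset.sum_const, nsmul_eq_mul]
        gcongr
        exact card_parentMaps_le n k

/-- Here the tree spans the component, so in addition all `k (n - k)` boundary edges are absent, and
they are disjoint from the tree edges. -/
theorem HasTailBounds.prob_component_eq (h : HasTailBounds P X σ M) {p : ℝ} (hp : 0 < p) {k : ℕ}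
    (hk : 2 ≤ k) :
    P.real {ω | ∃ C : (thresholdGraph (X ω) p).ConnectedComponent, componentOrder C = k}
      ≤ (Real.exp 1 * n) ^ k * ((12 * Real.exp 1 * p / σ) ^ (k - 1)
        * Real.exp (-(3 / 8 * (p / M))) ^ (k * (n - k))) := by
  have hσ := h.sigma_pos
  calc _ ≤ P.real (⋃ q ∈ parentMaps n k, {ω | (∀ e ∈ treeEdges q.1 q.2, X ω e ≤ p) ∧
          ∀ e ∈ cutEdges q.1, p < X ω e}) := by
        refine measureReal_mono ?_ (measure_ne_top _ _)
        rintro ω ⟨C, hC⟩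
        obtain ⟨q, hq, hqC, hle⟩ := C.exists_mem_parentMaps (by omega) hC.ge
        refine Set.mem_biUnion hq ⟨hle, fun e he => ?_⟩
        have hsupp : (q.1 : Set (Fin n)) = C.supp := by
          refine Set.eq_of_subset_of_ncard_le hqC ?_ (Set.toFinite _)
          rw [Set.ncard_coe_finset, (mem_parentMaps.1 hq).1.1, ← hC]
          rfl
        refine lt_of_mem_cutEdges (fun u v huv => ?_) he
        rw [← Finset.mem_coe, ← Finset.mem_coe, hsupp]
        exact ⟨fun hu => C.mem_supp_of_adj_mem_supp hu huv,
          fun hv => C.mem_supp_of_adj_mem_supp hv huv.symm⟩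
    _ ≤ ∑ q ∈ parentMaps n k, P.real {ω | (∀ e ∈ treeEdges q.1 q.2, X ω e ≤ p) ∧
          ∀ e ∈ cutEdges q.1, p < X ω e} :=
        measureReal_biUnion_finset_le _ _
    _ ≤ ∑ _q ∈ parentMaps n k, (12 * Real.exp 1 * p / σ) ^ (k - 1)
          * Real.exp (-(3 / 8 * (p / M))) ^ (k * (n - k)) := by
        refine Finset.sum_le_sum fun q hq => ?_
        obtain ⟨⟨hK, hπ, -⟩, hcard⟩ := mem_parentMaps.1 hq
        have := h.joint p hp (treeEdges q.1 q.2) (cutEdges q.1) (Finset.card_pos.1 (by omega))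
          (disjoint_treeEdges_cutEdges hπ)
        rwa [hcard, card_cutEdges, hK] at this
    _ ≤ _ := by
        rw [Finset.sum_const, nsmul_eq_mul]
        gcongr
        exact card_parentMaps_le n k

theorem HasTailBounds.prob_no_giant (h : HasTailBounds P X σ M) {p : ℝ} (hp : 0 < p)
    (hn : 3 ≤ n) :
    P.real {ω | ∀ C : (thresholdGraph (X ω) p).ConnectedComponent, 2 * componentOrder C ≤ n}
      ≤ 2 ^ n * Real.exp (-(3 / 8 * (p / M)) * ((n : ℝ) ^ 2 / 9)) := by
  have hM : 0 < M := h.sigma_pos.trans_le h.sigma_le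
  set I : Finset (Finset (Fin n)) :=
    Finset.univ.filter fun K => n ≤ 3 * K.card ∧ 3 * K.card ≤ 2 * n with hI
  calc _ ≤ P.real (⋃ K ∈ I, {ω | ∀ e ∈ cutEdges K, p < X ω e}) := by
        refine measureReal_mono ?_ (measure_ne_top _ _)
        intro ω hω
        obtain ⟨K, h1, h2, hK⟩ := SimpleGraph.exists_closed_finset (thresholdGraph (X ω) p)
          (by simpa [Fintype.card_fin, componentOrder] using hω)
        rw [Fintype.card_fin] at h1 h2
        exact Set.mem_biUnion (x := K) (by simp [hI, h1, h2])
          fun e he => lt_of_mem_cutEdges hK he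
    _ ≤ ∑ K ∈ I, P.real {ω | ∀ e ∈ cutEdges K, p < X ω e} := measureReal_biUnion_finset_le _ _
    _ ≤ ∑ _K ∈ I, Real.exp (-(3 / 8 * (p / M)) * ((n : ℝ) ^ 2 / 9)) := by
        refine Finset.sum_le_sum fun K hK => ?_
        simp only [hI, Finset.mem_filter, Finset.mem_univ, true_and] at hK
        have hpos : 0 < (cutEdges K).card := by
          rw [card_cutEdges]
          exact Nat.mul_pos (by omega) (by omega)
        refine (h.tail p hp _ (Finset.card_pos.1 hpos)).trans ?_
        rw [← Real.exp_nat_mul, Real.exp_le_exp, Nat.cast_sub (by omega), card_cutEdges,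
          Nat.cast_mul, Nat.cast_sub (by omega), mul_comm]
        have h0 : 0 ≤ 3 / 8 * (p / M) := by positivity
        refine mul_le_mul_of_nonpos_left ?_ (neg_nonpos.2 h0)
        have h1 : (n : ℝ) ≤ 3 * K.card := by exact_mod_cast hK.1
        have h2 : 3 * (K.card : ℝ) ≤ 2 * n := by exact_mod_cast hK.2
        have h3 : (3 : ℝ) ≤ n := by exact_mod_cast hn
        push_cast
        -- The cut has at least `2 n ^ 2 / 9` edges; for `n ≥ 3` the edge lost in the exponent of
        -- `tail` is covered by `n ^ 2 / 9`.
        nlinarith [mul_nonneg (sub_nonneg.2 h1) (sub_nonneg.2 h2)]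
    _ ≤ _ := by
        rw [Finset.sum_const, nsmul_eq_mul]
        gcongr
        have : I.card ≤ 2 ^ n := (Finset.card_le_univ I).trans (by simp)
        exact_mod_cast this

theorem existsUnique_component_or {n : ℕ} (G : SimpleGraph (Fin n)) :
    (∃! C : G.ConnectedComponent, (n : ℝ) / 2 < componentOrder C) ∨
      ∀ C : G.ConnectedComponent, 2 * componentOrder C ≤ n := by
  by_cases h : ∀ C : G.ConnectedComponent, 2 * componentOrder C ≤ n
  · exact Or.inr h
  left
  push Not at h
  obtain ⟨C, hC⟩ := h
  have key : ∀ D : G.ConnectedComponent, (n : ℝ) / 2 < componentOrder D ↔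
      n < 2 * componentOrder D := fun D => by
    rw [div_lt_iff₀ two_pos, mul_comm]
    exact_mod_cast Iff.rfl
  refine ⟨C, (key C).2 hC, fun D hD => ?_⟩
  have hD := (key D).1 hD
  by_contra hne
  have hdis := SimpleGraph.pairwise_disjoint_supp_connectedComponent G hne
  have h1 := Set.ncard_union_eq hdis (Set.toFinite _) (Set.toFinite _)
  have h2 : (D.supp ∪ C.supp).ncard ≤ n := by
    have := Set.ncard_le_card (D.supp ∪ C.supp)
    rwa [Nat.card_eq_fintype_card, Fintype.card_fin] at this
  unfold componentOrder at hC hD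
  omega

end Components

/-! ### Numerical estimates. -/

section Estimates

theorem one_lt_log_of_three_le {n : ℕ} (hn : 3 ≤ n) : 1 < Real.log n := by
  rw [Real.lt_log_iff_exp_lt (by positivity)]
  have : (3 : ℝ) ≤ n := by exact_mod_cast hn
  exact Real.exp_one_lt_d9.trans_le (by linarith)

theorem exp_neg_ceil_le {n : ℕ} (hn : 3 ≤ n) (β : ℝ) :
    n * Real.exp (-(⌈β * Real.log n⌉₊ : ℝ)) ≤ 1 / (n : ℝ) ^ (β - 1) := by
  have hn0 : (0 : ℝ) < n := by positivity
  have h1 : Real.exp (-(⌈β * Real.log n⌉₊ : ℝ)) ≤ (n : ℝ) ^ (-β) := by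
    rw [Real.rpow_def_of_pos hn0, Real.exp_le_exp]
    have := Nat.le_ceil (β * Real.log n)
    linarith
  calc n * Real.exp (-(⌈β * Real.log n⌉₊ : ℝ)) ≤ n * (n : ℝ) ^ (-β) := by gcongr
    _ = 1 / (n : ℝ) ^ (β - 1) := by
        rw [one_div, ← Real.rpow_neg hn0.le, neg_sub, sub_eq_add_neg, Real.rpow_add hn0,
          Real.rpow_one]

/-- One factor `e n` is left over from the tree count, the others pair with the `b`'s. The threshold
`e ^ (-6)` gives equality at `k = 2`. -/
theorem mul_pow_le_exp {n : ℝ} (hn : 0 < n) {b : ℝ} (hb : 0 ≤ b)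
    (hnb : n * b ≤ Real.exp (-6)) {k : ℕ} (hk : 2 ≤ k) :
    (Real.exp 1 * n) ^ k * b ^ (k - 1) ≤ n * Real.exp (-2) * Real.exp (-(k : ℝ)) := by
  obtain ⟨m, rfl⟩ : ∃ m, k = m + 1 := ⟨k - 1, by omega⟩
  have hm : (1 : ℝ) ≤ m := by exact_mod_cast (by omega : 1 ≤ m)
  calc (Real.exp 1 * n) ^ (m + 1) * b ^ (m + 1 - 1)
      = Real.exp 1 * n * (Real.exp 1 * (n * b)) ^ m := by
        rw [Nat.add_sub_cancel]; ring
    _ ≤ Real.exp 1 * n * (Real.exp 1 * Real.exp (-6)) ^ m := by gcongr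
    _ = n * Real.exp (1 - 5 * m) := by
        rw [← Real.exp_add, ← Real.exp_nat_mul, mul_comm (Real.exp 1) n, mul_assoc,
          ← Real.exp_add]
        congr 2
        ring
    _ ≤ n * Real.exp (-2 + -((m + 1 : ℕ) : ℝ)) := by
        gcongr
        push_cast
        linarith
    _ = _ := by rw [Real.exp_add, mul_assoc]

theorem sum_Icc_exp_neg_le (k m : ℕ) :
    ∑ j ∈ Finset.Icc k m, Real.exp (-(j : ℝ)) ≤ 2 * Real.exp (-(k : ℝ)) := by
  have h2 : 2 * Real.exp (-1) ≤ 1 := by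
    rw [Real.exp_neg, ← div_eq_mul_inv, div_le_one (Real.exp_pos 1)]
    linarith [Real.add_one_le_exp (1 : ℝ)]
  have key : ∀ m, k ≤ m → ∑ j ∈ Finset.Ico k m, Real.exp (-(j : ℝ))
      ≤ 2 * Real.exp (-(k : ℝ)) - 2 * Real.exp (-(m : ℝ)) := by
    intro m hm
    induction m, hm using Nat.le_induction with
    | base => simp
    | succ m hm ih =>
      rw [Finset.sum_Ico_succ_top hm]
      have h3 : Real.exp (-((m + 1 : ℕ) : ℝ)) = Real.exp (-(m : ℝ)) * Real.exp (-1) := by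
        rw [← Real.exp_add]; push_cast; congr 1; ring
      rw [h3]
      nlinarith [Real.exp_pos (-(m : ℝ))]
  rcases le_or_gt k m with h | h
  · have := key (m + 1) (by omega)
    rw [Finset.Ico_add_one_right_eq_Icc] at this
    have := Real.exp_pos (-((m + 1 : ℕ) : ℝ))
    linarith
  · rw [Finset.Icc_eq_empty (by omega), Finset.sum_empty]
    positivity

/-- Used with `u = p n / M` and `L = log (e M / σ)`. The decay splits into three parts `u / 16`: one
absorbs the linear factor, one absorbs `exp L`, and the last exceeds `12`; hence `192 = 12 · 16`. -/
theorem mul_exp_sub_le {u L : ℝ} (hL : 1 ≤ L) (hu : 192 * L < u) :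
    12 * u * Real.exp L * Real.exp (-(3 / 16 * u)) ≤ Real.exp (-6) := by
  have h1 : u / 16 ≤ Real.exp (u / 16) := by linarith [Real.add_one_le_exp (u / 16)]
  have h2 : (192 : ℝ) ≤ Real.exp 6 := by
    have := Real.exp_one_gt_d9
    have h3 : Real.exp 6 = Real.exp 1 ^ 6 := by rw [← Real.exp_nat_mul]; norm_num
    rw [h3]
    calc (192 : ℝ) ≤ 2.7 ^ 6 := by norm_num
      _ ≤ _ := by gcongr; linarith
  calc 12 * u * Real.exp L * Real.exp (-(3 / 16 * u))
      = 192 * (u / 16) * (Real.exp L * Real.exp (-(3 / 16 * u))) := by ring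
    _ ≤ Real.exp 6 * Real.exp (u / 16) * (Real.exp (u / 16) * Real.exp (-(3 / 16 * u))) := by
        have : 0 < u := by linarith
        gcongr
        linarith
    _ = Real.exp (6 - u / 16) := by
        rw [← Real.exp_add, ← Real.exp_add, ← Real.exp_add]; congr 1; ring
    _ ≤ _ := by rw [Real.exp_le_exp]; linarith

end Estimates

/-! ### The two regimes. -/

section MainBounds

theorem HasTailBounds.one_le_log {n : ℕ} {Ω : Type*} [MeasurableSpace Ω] {P : Measure Ω}
    {X : Ω → EdgeIdx n → ℝ} {σ M : ℝ} (h : HasTailBounds P X σ M) :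
    1 ≤ Real.log (Real.exp 1 * M / σ) := by
  have hσ := h.sigma_pos
  have hM := hσ.trans_le h.sigma_le
  rw [Real.le_log_iff_exp_le (by positivity), le_div_iff₀ hσ]
  exact mul_le_mul_of_nonneg_left h.sigma_le (Real.exp_pos 1).le

theorem HasTailBounds.mul_log_lt {n : ℕ} {Ω : Type*} [MeasurableSpace Ω] {P : Measure Ω}
    {X : Ω → EdgeIdx n → ℝ} {σ M : ℝ} (h : HasTailBounds P X σ M) (hn : 3 ≤ n) {p : ℝ}
    (hpM : 192 * M * Real.log (Real.exp 1 * M / σ) / n < p) :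
    192 * Real.log (Real.exp 1 * M / σ) < p * n / M := by
  have hM := h.sigma_pos.trans_le h.sigma_le
  rw [lt_div_iff₀ hM]
  rw [div_lt_iff₀ (by positivity)] at hpM
  linarith

variable {n : ℕ} {Ω : Type*} [MeasurableSpace Ω] {P : Measure Ω} [IsProbabilityMeasure P]
  {X : Ω → EdgeIdx n → ℝ} {σ M : ℝ}

theorem two_le_ceil_mul_log {n : ℕ} (hn : 3 ≤ n) {β : ℝ} (hβ : 1 < β) :
    2 ≤ ⌈β * Real.log n⌉₊ := by
  have := one_lt_log_of_three_le hn
  refine Nat.lt_ceil.2 ?_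
  push_cast
  nlinarith

theorem HasTailBounds.subcritical (h : HasTailBounds P X σ M) (hn : 3 ≤ n) {β p : ℝ} (hβ : 1 < β)
    (hp : 0 < p) (hpσ : p < Real.exp (-7) / 12 * σ / n) :
    P.real {ω | ∃ C : (thresholdGraph (X ω) p).ConnectedComponent,
        β * Real.log n ≤ componentOrder C} < 12 / (n : ℝ) ^ (β - 1) := by
  have hσ := h.sigma_pos
  have hn0 : (0 : ℝ) < n := by positivity
  have hk := two_le_ceil_mul_log hn hβ
  have hnb : n * (12 * Real.exp 1 * p / σ) ≤ Real.exp (-6) := by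
    rw [lt_div_iff₀ hn0] at hpσ
    rw [show n * (12 * Real.exp 1 * p / σ) = 12 * Real.exp 1 * (p * n) / σ by ring,
      div_le_iff₀ hσ]
    calc 12 * Real.exp 1 * (p * n) ≤ 12 * Real.exp 1 * (Real.exp (-7) / 12 * σ) := by gcongr
      _ = (Real.exp 1 * Real.exp (-7)) * σ := by ring
      _ = Real.exp (-6) * σ := by rw [← Real.exp_add]; norm_num
  calc _ ≤ P.real {ω | ∃ C : (thresholdGraph (X ω) p).ConnectedComponent,
          ⌈β * Real.log n⌉₊ ≤ componentOrder C} := by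
        refine measureReal_mono ?_ (measure_ne_top _ _)
        rintro ω ⟨C, hC⟩
        exact ⟨C, Nat.ceil_le.2 hC⟩
    _ ≤ n * Real.exp (-2) * Real.exp (-(⌈β * Real.log n⌉₊ : ℝ)) :=
        (h.prob_component_ge hp hk).trans (mul_pow_le_exp hn0 (by positivity) hnb hk)
    _ ≤ Real.exp (-2) * (1 / (n : ℝ) ^ (β - 1)) := by
        rw [mul_comm (n : ℝ), mul_assoc]
        gcongr
        exact exp_neg_ceil_le hn β
    _ < 12 * (1 / (n : ℝ) ^ (β - 1)) := by
        have : Real.exp (-2) ≤ 1 := Real.exp_le_one_iff.2 (by norm_num)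
        have h2 : 0 < 1 / (n : ℝ) ^ (β - 1) := by positivity
        nlinarith
    _ = _ := by ring

theorem HasTailBounds.supercritical_gap (h : HasTailBounds P X σ M) (hn : 3 ≤ n) {β p : ℝ}
    (hβ : 1 < β) (hp : 0 < p) (hpM : 192 * M * Real.log (Real.exp 1 * M / σ) / n < p) :
    P.real {ω | ∃ C : (thresholdGraph (X ω) p).ConnectedComponent,
        β * Real.log n ≤ componentOrder C ∧ (componentOrder C : ℝ) ≤ n / 2}
      < 1 / (n : ℝ) ^ (β - 1) := by
  have hσ := h.sigma_pos
  have hM := hσ.trans_le h.sigma_le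
  have hn0 : (0 : ℝ) < n := by positivity
  have hk := two_le_ceil_mul_log hn hβ
  set k₀ := ⌈β * Real.log n⌉₊
  have hterm : ∀ k ∈ Finset.Icc k₀ (n / 2),
      P.real {ω | ∃ C : (thresholdGraph (X ω) p).ConnectedComponent, componentOrder C = k}
        ≤ n * Real.exp (-2) * Real.exp (-(k : ℝ)) := by
    intro k hkmem
    rw [Finset.mem_Icc] at hkmem
    have hk2 : 2 ≤ k := hk.trans hkmem.1
    refine (h.prob_component_eq hp hk2).trans ?_
    -- Since `n - k ≥ n / 2`, the boundary edges can be charged to the `k - 1` tree edges, at least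
    -- `n / 2` to each.
    have hq : Real.exp (-(3 / 8 * (p / M))) ^ (k * (n - k))
        ≤ Real.exp (-(3 / 16 * (p * n / M))) ^ (k - 1) := by
      rw [← Real.exp_nat_mul, ← Real.exp_nat_mul, Real.exp_le_exp, Nat.cast_mul,
        Nat.cast_sub (by omega), Nat.cast_sub (by omega)]
      have h1 : 2 * (k : ℝ) ≤ n := by exact_mod_cast (by omega : 2 * k ≤ n)
      have h3 : (k : ℝ) * (n / 2) ≤ k * (n - k) := by gcongr; linarith
      have h4 : (0 : ℝ) ≤ 3 / 8 * (p / M) := by positivity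
      have h5 : ((k : ℝ) - (1 : ℕ)) * (n / 2) ≤ k * (n - k) := by push_cast; nlinarith
      have h6 := mul_le_mul_of_nonneg_left h5 h4
      have h7 : 3 / 8 * (p / M) * (((k : ℝ) - (1 : ℕ)) * (n / 2))
          = ((k : ℝ) - (1 : ℕ)) * (3 / 16 * (p * n / M)) := by ring
      rw [h7] at h6
      linarith
    have hnb : n * (12 * Real.exp 1 * p / σ * Real.exp (-(3 / 16 * (p * n / M))))
        ≤ Real.exp (-6) := by
      refine le_trans (le_of_eq ?_) (mul_exp_sub_le h.one_le_log (h.mul_log_lt hn hpM))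
      rw [Real.exp_log (by positivity)]
      field_simp
    calc _ ≤ (Real.exp 1 * n) ^ k * ((12 * Real.exp 1 * p / σ) ^ (k - 1)
          * Real.exp (-(3 / 16 * (p * n / M))) ^ (k - 1)) := by gcongr
      _ ≤ _ := by
          rw [← mul_pow]
          exact mul_pow_le_exp hn0 (by positivity) hnb hk2
  calc _ ≤ P.real (⋃ k ∈ Finset.Icc k₀ (n / 2),
          {ω | ∃ C : (thresholdGraph (X ω) p).ConnectedComponent, componentOrder C = k}) := by
        refine measureReal_mono ?_ (measure_ne_top _ _)
        rintro ω ⟨C, hC1, hC2⟩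
        refine Set.mem_biUnion (x := componentOrder C) ?_ ⟨C, rfl⟩
        rw [Finset.mem_coe, Finset.mem_Icc]
        refine ⟨Nat.ceil_le.2 hC1, ?_⟩
        rw [le_div_iff₀ two_pos] at hC2
        rw [Nat.le_div_iff_mul_le two_pos]
        exact_mod_cast hC2
    _ ≤ ∑ k ∈ Finset.Icc k₀ (n / 2), n * Real.exp (-2) * Real.exp (-(k : ℝ)) :=
        (measureReal_biUnion_finset_le _ _).trans (Finset.sum_le_sum hterm)
    _ ≤ n * Real.exp (-2) * (2 * Real.exp (-(k₀ : ℝ))) := by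
        rw [← Finset.mul_sum]
        gcongr
        exact sum_Icc_exp_neg_le _ _
    _ = 2 * Real.exp (-2) * (n * Real.exp (-(k₀ : ℝ))) := by ring
    _ ≤ 2 * Real.exp (-2) * (1 / (n : ℝ) ^ (β - 1)) := by
        gcongr
        exact exp_neg_ceil_le hn β
    _ < 1 * (1 / (n : ℝ) ^ (β - 1)) := by
        have h1 : 2 * Real.exp (-2) < 1 := by
          rw [Real.exp_neg, ← div_eq_mul_inv, div_lt_one (Real.exp_pos 2)]
          linarith [Real.add_one_le_exp (2 : ℝ)]
        gcongr
    _ = _ := one_mul _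

theorem HasTailBounds.supercritical_giant (h : HasTailBounds P X σ M) (hn : 3 ≤ n) {β p : ℝ}
    (hβ : 1 < β) (hp : 0 < p) (hpM : 192 * M * Real.log (Real.exp 1 * M / σ) / n < p) :
    1 - 5 * β / Real.log n - 1 / (n : ℝ) ^ (β - 1)
      < P.real {ω | ∃! C : (thresholdGraph (X ω) p).ConnectedComponent,
          (n : ℝ) / 2 < componentOrder C} := by
  have hM := h.sigma_pos.trans_le h.sigma_le
  have hn0 : (0 : ℝ) < n := by positivity
  have hlog := one_lt_log_of_three_le hn
  have hcover : (1 : ℝ) ≤ P.real {ω | ∃! C : (thresholdGraph (X ω) p).ConnectedComponent,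
          (n : ℝ) / 2 < componentOrder C}
      + P.real {ω | ∀ C : (thresholdGraph (X ω) p).ConnectedComponent,
          2 * componentOrder C ≤ n} := by
    refine le_trans (le_of_eq ?_) (measureReal_union_le _ _)
    rw [← probReal_univ (μ := P)]
    congr 1
    exact (Set.eq_univ_of_forall fun ω => existsUnique_component_or (thresholdGraph (X ω) p)).symm
  have hu : 192 < p * n / M := by linarith [h.mul_log_lt hn hpM, h.one_le_log]
  have hsmall : P.real {ω | ∀ C : (thresholdGraph (X ω) p).ConnectedComponent,
      2 * componentOrder C ≤ n} ≤ Real.exp (-(n : ℝ)) := by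
    refine (h.prob_no_giant hp hn).trans ?_
    have h1 : (2 : ℝ) ^ n ≤ Real.exp n := by
      rw [← mul_one (n : ℝ), Real.exp_nat_mul]
      gcongr
      linarith [Real.add_one_le_exp (1 : ℝ)]
    calc (2 : ℝ) ^ n * Real.exp (-(3 / 8 * (p / M)) * ((n : ℝ) ^ 2 / 9))
        ≤ Real.exp n * Real.exp (-(3 / 8 * (p / M)) * ((n : ℝ) ^ 2 / 9)) := by gcongr
      _ = Real.exp (n - p * n / M * n / 24) := by
          rw [← Real.exp_add]; congr 1; ring
      _ ≤ _ := by
          rw [Real.exp_le_exp]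
          -- As `p n / M > 192`, the cut contributes at most `exp (-8 n)`, which outweighs the `exp
          -- n` bounding the number of vertex sets.
          nlinarith
  have hfin : Real.exp (-(n : ℝ)) < 5 * β / Real.log n := by
    rw [lt_div_iff₀ (by linarith)]
    have h1 : Real.log n ≤ Real.exp n :=
      (Real.log_le_self hn0.le).trans (by linarith [Real.add_one_le_exp (n : ℝ)])
    calc Real.exp (-(n : ℝ)) * Real.log n ≤ Real.exp (-(n : ℝ)) * Real.exp n := by gcongr
      _ = 1 := by rw [← Real.exp_add]; simp
      _ < 5 * β := by linarith
  have hpos : 0 < 1 / (n : ℝ) ^ (β - 1) := by positivity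
  linarith

end MainBounds

theorem theorem2 :
    ∃ c₁ c₂ : ℝ, 0 < c₁ ∧ 0 < c₂ ∧
      ∀ (n : ℕ), 3 ≤ n →
      ∀ (Ω : Type*) [MeasurableSpace Ω] (P : Measure Ω) [IsProbabilityMeasure P]
        (X : Ω → EdgeIdx n → ℝ) (f : (EdgeIdx n → ℝ) → ℝ),
        Measurable X → Measurable f → IsLogConcaveDownMonotone f →
        P.map X = volume.withDensity (fun x => ENNReal.ofReal (f x)) →
        maxCondSecondMoment f ≠ ∞ →
      ∀ (β : ℝ), 1 < β → ∀ (p : ℝ), 0 < p →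
        (p < c₁ * sigmaMin P X / n →
          P.real {ω | ∃ C : (thresholdGraph (X ω) p).ConnectedComponent,
              β * Real.log n ≤ componentOrder C}
            < 12 / (n : ℝ) ^ (β - 1)) ∧
        (c₂ * maxCondRMS f * Real.log (Real.exp 1 * maxCondRMS f / sigmaMin P X) / n < p →
          P.real {ω | ∃ C : (thresholdGraph (X ω) p).ConnectedComponent,
              β * Real.log n ≤ componentOrder C ∧ (componentOrder C : ℝ) ≤ n / 2}
            < 1 / (n : ℝ) ^ (β - 1) ∧
          1 - 5 * β / Real.log n - 1 / (n : ℝ) ^ (β - 1)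
            < P.real {ω | ∃! C : (thresholdGraph (X ω) p).ConnectedComponent,
                (n : ℝ) / 2 < componentOrder C}) := by
  -- The first constant makes `n · 12 e p / σ` at most `e ^ (-6)`, as `mul_pow_le_exp` requires; the
  -- second is the one in `mul_exp_sub_le`.
  refine ⟨Real.exp (-7) / 12, 192, by positivity, by norm_num, ?_⟩
  intro n hn Ω _ P _ X f hX hf hlc hP hfin β hβ p hp
  have : Nontrivial (EdgeIdx n) := by
    refine ⟨⟨(⟨0, by omega⟩, ⟨1, by omega⟩), by simp⟩,
      ⟨(⟨0, by omega⟩, ⟨2, by omega⟩), by simp⟩, ?_⟩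
    simp
  have h : HasTailBounds P X (sigmaMin P X) (maxCondRMS f) :=
    hlc.hasTailBounds hf hX hP hfin
  exact ⟨fun hpσ => h.subcritical hn hβ hp hpσ, fun hpM =>
    ⟨h.supercritical_gap hn hβ hp hpM, h.supercritical_giant hn hβ hp hpM⟩⟩
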